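/- Let $k=\mathbb F_q$ be a finite field with $q$ elements and let $K$ be a global function field with full constant field $k$, i.e. $K$ is a finite extension of a rational function field $k(t)$ and $k$ is algebraically closed in $K$. A place $P$ of $K$ is a normalised (surjective) discrete valuation $\nu_P:K\to\mathbb Z\cup\{\infty\}$ that is trivial on $k$; let $K_P$ be the completion of $K$ at $P$ and $\hat{\mathcal O}_P=\{x\in K_P:\nu_P(x)\ge 0\}$. Let $$\hat{\mathbb A}_K=\Big\{(x_P)_P\in\prod_P K_P : x_P\in\hat{\mathcal O}_P\text{ for almost all }P\Big\},\qquad \hat{\mathcal O}_K=\prod_P\hat{\mathcal O}_P,$$ be the adele ring with the restricted product topology and its subring of everywhere integral adeles. A divisor is a finitely supported family $D=(D_P)_P$ of integers; divisors are ordered coefficientwise, and $L(D)=\{x\in K : \nu_P(x)+D_P\ge 0\text{ for all }P\}$. Let $\mathbb A_K=\{(a_P)_P\in\prod_P K : \nu_P(a_P)\ge 0\text{ for almost all }P\}$ and $\mathbb A_K(D)=\{a\in\mathbb A_K : \nu_P(a_P)+D_P\ge 0\text{ for all }P\}$. A Weil differential is a $k$-linear map $\omega:\mathbb A_K\to k$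 that vanishes on $\mathbb A_K(D)+K$ for some divisor $D$ (with $K$ embedded diagonally); a canonical divisor is the greatest divisor $W$ such that a given nonzero Weil differential vanishes on $\mathbb A_K(W)+K$. The genus is $g=\dim_k L(W)$ for a canonical divisor $W$. Then $K$ embeds diagonally in $\hat{\mathbb A}_K$ as a discrete subgroup; canonical divisors exist, and $\dim_k L(W)$ is finite and the same number $g$ for all canonical divisors $W$; and there is a Haar measure $\mu$ on $(\hat{\mathbb A}_K,+)$ with $\mu(\hat{\mathcal O}_K)=1$. For every such $\mu$ there is a measure $\nu$ on $\hat{\mathbb A}_K/K$ induced by $\mu$ and the counting measure on $K$, that is, one with $$\int_{\hat{\mathbb A}_K} f\,d\mu=\int_{\hat{\mathbb A}_K/K}\ \sum_{x\in c} f(x)\,d\nu(c)\qquad\text{for all measurable } f:\hat{\mathbb A}_K\to[0,\infty],$$ and every such $\nu$ satisfies $$\nu\big(\hat{\mathbb A}_K/K\big)=q^{\,g-1}.$$ -/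

import Mathlib

open scoped WithZero RestrictedProduct ENNReal
open MeasureTheory

/-- A place of `K / k`, given by the unique normalised valuation in its class: a surjective
discrete valuation of `K`, trivial on `k`. In terms of the additive valuation `ν` of the place,
`val x = exp (-ν x)`, with `val 0 = 0`. -/
structure Place (k K : Type*) [Field k] [Field K] [Algebra k K] where
  /-- the normalised valuation, written multiplicatively -/
  val : Valuation K ℤᵐ⁰
  surjective : Function.Surjective val
  map_const : ∀ c : k, c ≠ 0 → val (algebraMap k K c) = 1

namespace Place

variable {k K : Type*} [Field k] [Field K] [Algebra k K]

theorem val_const_le (P : Place k K) (c : k) : P.val (algebraMap k K c) ≤ 1 := by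
  by_cases h : c = 0
  · simp [h]
  · exact (P.map_const c h).le

theorem val_smul_le (P : Place k K) (c : k) (x : K) : P.val (c • x) ≤ P.val x := by
  rw [Algebra.smul_def, map_mul]
  exact mul_le_of_le_one_left' (P.val_const_le c)

/-- The local field `K_P`, the completion of `K` at `P`. -/
abbrev LocalField (P : Place k K) : Type _ := P.val.Completion

/-- The ring of integers of the local field `K_P`, the completion of the local ring at `P`. -/
noncomputable abbrev localIntegers (P : Place k K) : ValuationSubring P.LocalField :=
  (Valued.v (R := P.LocalField) (Γ₀ := ℤᵐ⁰)).valuationSubring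

/-- The embedding of `K` into its completion at `P`. -/
noncomputable def toLocal (P : Place k K) : K →+* P.LocalField :=
  (UniformSpace.Completion.coeRingHom (α := WithVal P.val)).comp
    (WithVal.equiv P.val).symm.toRingHom

end Place

section Divisors

variable (k K : Type*) [Field k] [Field K] [Algebra k K]

/-- Weil divisors: the free abelian group on the places, with its coefficientwise order. -/
abbrev WeilDivisor : Type _ := Place k K →₀ ℤ

/-- The Riemann–Roch space `L(D)`: all `x` in `K` with `ν_P x + D P ≥ 0` at every place `P`,
together with `0`. -/
def riemannRochSpace (D : WeilDivisor k K) : Submodule k K where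
  carrier := {x | ∀ P : Place k K, P.val x ≤ WithZero.exp (D P)}
  zero_mem' := fun P => by simp
  add_mem' := fun {x y} hx hy P => (P.val.map_add x y).trans (max_le (hx P) (hy P))
  smul_mem' := fun c x hx P => (P.val_smul_le c x).trans (hx P)

/-- The space of repartitions: families `(a_P)` of elements of `K` that are integral at almost
all places. -/
def repartitions : Submodule k (Place k K → K) where
  carrier := {a | ∀ᶠ P : Place k K in Filter.cofinite, P.val (a P) ≤ 1}
  zero_mem' := by
    rw [Set.mem_ofPred_eq]
    exact Filter.Eventually.of_forall fun P => by simp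
  add_mem' := fun {a b} ha hb => by
    rw [Set.mem_ofPred_eq] at ha hb ⊢
    filter_upwards [ha, hb] with P h₁ h₂
    exact (P.val.map_add _ _).trans (max_le h₁ h₂)
  smul_mem' := fun c a ha => by
    rw [Set.mem_ofPred_eq] at ha ⊢
    filter_upwards [ha] with P h
    exact (P.val_smul_le c _).trans h

/-- The `k`-linear functional `ω` on repartitions vanishes on `A(D) + K`: on all repartitions `a`
with `ν_P (a_P) + D P ≥ 0` at every place `P`, and on the diagonal image of `K`. -/
def VanishesOn (ω : repartitions k K →ₗ[k] k) (D : WeilDivisor k K) : Prop :=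
  (∀ a : repartitions k K,
      (∀ P : Place k K, P.val (a.1 P) ≤ WithZero.exp (D P)) → ω a = 0) ∧
  ∀ a : repartitions k K, (∃ x : K, ∀ P : Place k K, a.1 P = x) → ω a = 0

/-- A Weil differential: a functional on repartitions that vanishes on `A(D) + K` for some `D`. -/
def IsWeilDifferential (ω : repartitions k K →ₗ[k] k) : Prop :=
  ∃ D : WeilDivisor k K, VanishesOn k K ω D

/-- A canonical divisor: the largest divisor `W` such that a given nonzero Weil differential
vanishes on `A(W) + K`. -/
def IsCanonicalDivisor (W : WeilDivisor k K) : Prop :=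
  ∃ ω : repartitions k K →ₗ[k] k, IsWeilDifferential k K ω ∧ ω ≠ 0 ∧
    IsGreatest {D : WeilDivisor k K | VanishesOn k K ω D} W

/-- `g` is the genus: canonical divisors exist, and each canonical divisor `W` has
`dim_k L(W) = g`. -/
def IsGenus (g : ℕ) : Prop :=
  (∃ W : WeilDivisor k K, IsCanonicalDivisor k K W) ∧
  ∀ W : WeilDivisor k K, IsCanonicalDivisor k K W →
    Module.Finite k (riemannRochSpace k K W) ∧ Module.finrank k (riemannRochSpace k K W) = g

end Divisors

section Adeles

variable (k K : Type*) [Field k] [Field K] [Algebra k K]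

/-- The adele ring of `K`: the restricted product of all local fields `K_P` with respect to their
rings of integers, with the restricted product topology. -/
noncomputable abbrev FunctionFieldAdeles : Type _ :=
  Πʳ P : Place k K, [P.LocalField, P.localIntegers]

noncomputable instance : MeasurableSpace (FunctionFieldAdeles k K) := borel _

instance : BorelSpace (FunctionFieldAdeles k K) := ⟨rfl⟩

/-- The subset of adeles that are integral at every place. -/
def integralAdeles : Set (FunctionFieldAdeles k K) :=
  {a | ∀ P : Place k K, a P ∈ P.localIntegers}

/-- The diagonal image of `K` in the adele ring, as an additive subgroup. -/
noncomputable def principalAdeles : AddSubgroup (FunctionFieldAdeles k K) where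
  carrier := {a | ∃ x : K, ∀ P : Place k K, a P = P.toLocal x}
  zero_mem' := ⟨0, fun P => by simp⟩
  add_mem' := by
    rintro a b ⟨x, hx⟩ ⟨y, hy⟩
    exact ⟨x + y, fun P => by simp [hx P, hy P]⟩
  neg_mem' := by
    rintro a ⟨x, hx⟩
    exact ⟨-x, fun P => by simp [hx P]⟩

end Adeles

/-- `ν` is the measure on `G / Γ` induced by `μ` on `G` and the counting measure on `Γ`:
integrating over `G` amounts to summing over the cosets of `Γ` and integrating over `G / Γ`. -/
def IsQuotientMeasure {G : Type*} [AddCommGroup G] [MeasurableSpace G] (Γ : AddSubgroup G)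
    (μ : Measure G) (ν : Measure (G ⧸ Γ)) : Prop :=
  ∀ f : G → ℝ≥0∞, Measurable f →
    ∫⁻ x, f x ∂μ = ∫⁻ c, ∑' x : {x : G // (QuotientAddGroup.mk x : G ⧸ Γ) = c}, f x.1 ∂ν

/-! ### Independence over k(z), and the index of zV in V -/

section Independence

open Polynomial

variable {k K : Type*} [Field k] [Field K] [Algebra k K]

/-! Write Â for the adeles, H for the integral adeles and Γ for the diagonal K. Choosing one H-coset
in each class modulo H + Γ gives a set U of measure [Â : H + Γ] μ(H) which every Γ-coset meets in
exactly |H ∩ Γ| points. The quotient formula for the indicator of U reads |H ∩ Γ| ν(Â/Γ) = [Â : H +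
Γ] μ(H) (`IsQuotientMeasure.measure_univ`). Here H ∩ Γ = L(0) = k. Since K is dense in each
completion, [Â : H + Γ] is the index of A(0) + K in the repartitions, `specialityIndex 0`; call it
i(0). Duality turns it into |L(W)| = q^g, whence q ν(Â/Γ) = q^g.

The function field theory behind this is done by counting: k is finite, so dimensions become indices
of additive groups, deg D becomes the norm N(D) = q^(deg D), and exact sequences become
multiplicativity of relative indices. The engine is [V : zV] ≤ q^[K:k(z)] for a k-space V stable
under z (`relIndex_map_mulLeft`). It gives finite residue fields, discreteness of valuation rings,
finiteness of zeros and, with weak approximation, the bound [K : k(z)] for the degree of the zeros.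
Counting L(C + n(z)_∞) for large n gives the reverse bound for poles, hence degree 0 for principal
divisors, Riemann's inequality and Riemann–Roch before duality, i(D) N(D) q = i(0) |L(D)|
(`specialityIndex_mul_divisorNorm`).

For duality, i(D) counts the differentials vanishing on A(D) + K. Two K-independent differentials
would make i(-D) grow like N(D)², but it is O(N(D)). So all differentials are multiples xω of one ω,
and x ↦ xω maps L(W) bijectively onto those counted by i(0)
(`IsCanonicalDivisor.card_riemannRochSpace`). -/

theorem eq_zero_of_sum_aeval_mul_eq_zero {ι : Type*} [Fintype ι] {V : Submodule k K} {z : K}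
    (hz : z ≠ 0) (hV : ∀ x ∈ V, z * x ∈ V) {v : ι → K} (hv : ∀ i, v i ∈ V)
    (hind : ∀ c : ι → k, (∃ y ∈ V, ∑ i, c i • v i = z * y) → ∀ i, c i = 0) (n : ℕ) :
    ∀ p : ι → k[X], (∀ i, (p i).degree < n) → ∑ i, aeval z (p i) * v i = 0 → ∀ i, p i = 0 := by
  have haeval : ∀ (p : k[X]) (x : K), x ∈ V → aeval z p * x ∈ V := by
    intro p x hx
    induction p using Polynomial.induction_on' with
    | add p q hp hq => rw [map_add, add_mul]; exact V.add_mem hp hq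
    | monomial m a =>
      rw [aeval_monomial, mul_assoc, ← Algebra.smul_def]
      refine V.smul_mem _ ?_
      induction m with
      | zero => simpa using hx
      | succ m ih => rw [pow_succ', mul_assoc]; exact hV _ ih
  induction n with
  | zero =>
    intro p hp _ i
    simpa using hp i
  | succ n ih =>
    intro p hp hsum
    have hsplit : ∀ i, aeval z (p i) * v i
        = z * (aeval z (p i).divX * v i) + (p i).coeff 0 • v i := by
      intro i
      conv_lhs => rw [← divX_mul_X_add (p i)]
      simp only [map_add, map_mul, aeval_X, aeval_C, Algebra.smul_def]
      ring
    simp_rw [hsplit, Finset.sum_add_distrib, ← Finset.mul_sum] at hsum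
    -- Modulo zV only the constant coefficients survive, so `hind` kills them. Cancelling z then
    -- leaves a relation of lower degree between the `divX`.
    have hc : ∀ i, (p i).coeff 0 = 0 := by
      refine hind _ ⟨-∑ i, aeval z (p i).divX * v i, ?_, ?_⟩
      · exact V.neg_mem (V.sum_mem fun i _ => haeval _ _ (hv i))
      · linear_combination hsum
    have hd : ∀ i, (p i).divX = 0 := by
      refine ih _ (fun i => ?_) ?_
      · by_cases h0 : p i = 0
        · simp only [h0, divX_zero, degree_zero]; exact WithBot.bot_lt_coe _
        · have h1 := degree_divX_lt h0
          have h2 := hp i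
          rw [degree_eq_natDegree h0] at h1 h2
          refine h1.trans_le ?_
          have : (p i).natDegree < n + 1 := by exact_mod_cast h2
          exact_mod_cast Nat.lt_succ_iff.mp this
      · simpa [hc, hz] using hsum
    intro i
    rw [← divX_mul_X_add (p i), hd i, hc i]
    simp

open scoped IntermediateField.algebraAdjoinAdjoin in
-- `hind` is k-independence modulo zV. Clearing denominators reduces a relation over k(z) to one
-- over k[z], which the polynomial lemma excludes.
theorem linearIndependent_adjoin_of_modEq {ι : Type*} [Finite ι] {V : Submodule k K} {z : K}
    (hz : z ≠ 0) (hV : ∀ x ∈ V, z * x ∈ V) {v : ι → K} (hv : ∀ i, v i ∈ V)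
    (hind : ∀ c : ι → k, (∃ y ∈ V, ∑ᶠ i, c i • v i = z * y) → ∀ i, c i = 0) :
    LinearIndependent (IntermediateField.adjoin k {z}) v := by
  have := Fintype.ofFinite ι
  rw [← LinearIndependent.iff_fractionRing (R := Algebra.adjoin k {z}), Fintype.linearIndependent_iff]
  intro g hg i
  have hp : ∀ i, ∃ p : k[X], aeval z p = (g i : K) := fun i => by
    have : ∀ x ∈ Algebra.adjoin k {z}, ∃ p : k[X], aeval z p = x := fun x hx => by
      rwa [Algebra.adjoin_singleton_eq_range_aeval] at hx
    exact this _ (g i).2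
  choose p hp using hp
  have h0 := eq_zero_of_sum_aeval_mul_eq_zero hz hV hv
    (fun c hc => hind c (by simpa [finsum_eq_sum_of_fintype] using hc))
    (Finset.univ.sup (fun i => (p i).natDegree) + 1) p
    (fun i => degree_le_natDegree.trans_lt (by
      have := Finset.le_sup (f := fun i => (p i).natDegree) (Finset.mem_univ i)
      exact_mod_cast Nat.lt_succ_iff.mpr this))
    (by simp_rw [hp]; exact hg) i
  ext
  rw [← hp, h0]
  simp

/-- Multiplication by `z` has finite cokernel on every `k`-subspace that it preserves. -/
theorem relIndex_map_mulLeft [Finite k] (V : Submodule k K) {z : K} (hz : z ≠ 0)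
    (hV : ∀ x ∈ V, z * x ∈ V) [FiniteDimensional (IntermediateField.adjoin k {z}) K] :
    (V.toAddSubgroup.map (AddMonoidHom.mulLeft z)).relIndex V.toAddSubgroup ≠ 0 ∧
    (V.toAddSubgroup.map (AddMonoidHom.mulLeft z)).relIndex V.toAddSubgroup ≤
      Nat.card k ^ Module.finrank (IntermediateField.adjoin k {z}) K := by
  let W : Submodule k V := (V.map (LinearMap.mulLeft k z)).comap V.subtype
  have hidx : (V.toAddSubgroup.map (AddMonoidHom.mulLeft z)).relIndex V.toAddSubgroup
      = Nat.card (V ⧸ W) := rfl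
  -- W is zV inside V. A k-independent family in V/zV lifts to a k(z)-independent family in K.
  have hrank : Module.rank k (V ⧸ W) ≤ Module.finrank (IntermediateField.adjoin k {z}) K := by
    refine rank_le fun s hs => ?_
    choose f hf using fun i : s => W.mkQ_surjective i.1
    have := linearIndependent_adjoin_of_modEq (v := fun i => (f i : K)) hz hV (fun i => (f i).2) (by
      rintro c ⟨y, hy, hc⟩
      rw [finsum_eq_sum_of_fintype] at hc
      rw [Fintype.linearIndependent_iff] at hs
      refine hs c ?_
      simp_rw [← hf, ← map_smul, ← map_sum]
      rw [Submodule.mkQ_apply, Submodule.Quotient.mk_eq_zero]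
      exact ⟨y, hy, by rw [LinearMap.mulLeft_apply, ← hc]; simp⟩)
    simpa using this.fintype_card_le_finrank
  have : Module.Finite k (V ⧸ W) := Module.rank_lt_aleph0_iff.mp
    (hrank.trans_lt (Cardinal.natCast_lt_aleph0))
  have : Finite (V ⧸ W) := Module.finite_of_finite k
  rw [hidx]
  refine ⟨Nat.card_pos.ne', ?_⟩
  rw [Module.natCard_eq_pow_finrank (K := k)]
  refine Nat.pow_le_pow_right Nat.card_pos ?_
  rw [← Module.finrank_eq_rank] at hrank
  exact_mod_cast hrank

end Independence

/-- `K` is a function field in one variable over `k`, with `k` algebraically closed in `K`. -/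
class IsFunctionFieldOfConst (k K : Type*) [Field k] [Field K] [Algebra k K] : Prop where
  finite_adjoin : ∀ z : K, Transcendental k z →
    FiniteDimensional (IntermediateField.adjoin k {z}) K
  mem_range : ∀ x : K, IsAlgebraic k x → x ∈ (algebraMap k K).range
  exists_transcendental : ∃ t : K, Transcendental k t

/-! ### Existence of places -/

section Places

variable {k K : Type*} [Field k] [Field K] [Algebra k K]

theorem Place.transcendental_of_val_lt_one [IsFunctionFieldOfConst k K] (P : Place k K) {x : K}
    (h0 : x ≠ 0) (h : P.val x < 1) : Transcendental k x := by
  intro halg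
  obtain ⟨c, rfl⟩ := IsFunctionFieldOfConst.mem_range x halg
  exact h.ne (P.map_const c (by rintro rfl; simp at h0))

theorem Place.exists_val_eq (P : Place k K) (n : ℤ) : ∃ x : K, x ≠ 0 ∧ P.val x = WithZero.exp n := by
  obtain ⟨x, hx⟩ := P.surjective (WithZero.exp n)
  exact ⟨x, fun h => WithZero.exp_ne_zero (by rw [← hx, h, map_zero]), hx⟩

/-- A nonunit b ≠ 0 of B is not constant, hence transcendental, and B is a k-space stable under b,
so B/bB is finite. This makes B Noetherian; a Noetherian valuation ring that is not a field is
discrete, and its valuation is the required place. -/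
theorem ValuationSubring.exists_place [Finite k] [IsFunctionFieldOfConst k K] (B : ValuationSubring K)
    (hk : ∀ c : k, algebraMap k K c ∈ B) {y : K} (hy0 : y ≠ 0) (hy : y ∈ B.nonunits) :
    ∃ P : Place k K, P.val y < 1 := by
  let V : Subalgebra k K := { B.toSubring with algebraMap_mem' := hk }
  have hfin : ∀ b : B, b ≠ 0 → Finite (B ⧸ Ideal.span {b}) := by
    intro b hb
    have hb0 : (b : K) ≠ 0 := by simpa using hb
    by_cases hu : (b : K)⁻¹ ∈ B
    · have : IsUnit b := IsUnit.of_mul_eq_one ⟨_, hu⟩ (Subtype.ext (by simp [hb0]))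
      rw [Ideal.span_singleton_eq_top.mpr this]
      infer_instance
    have htr : Transcendental k (b : K) := by
      intro halg
      obtain ⟨c, hc⟩ := IsFunctionFieldOfConst.mem_range _ halg
      refine hu ?_
      rw [← hc, ← map_inv₀]
      exact hk _
    have := IsFunctionFieldOfConst.finite_adjoin _ htr
    have h := (relIndex_map_mulLeft (Subalgebra.toSubmodule V) hb0
      (fun x hx => B.mul_mem _ _ b.2 hx)).1
    have e : (((Subalgebra.toSubmodule V).toAddSubgroup.map
        (AddMonoidHom.mulLeft (b : K))).comap B.subtype.toAddMonoidHom)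
        = Submodule.toAddSubgroup (Ideal.span {b}) := by
      ext x
      rw [AddSubgroup.mem_comap, Submodule.mem_toAddSubgroup, Ideal.mem_span_singleton]
      constructor
      · rintro ⟨w, hw, hwx⟩
        exact ⟨⟨w, hw⟩, Subtype.ext hwx.symm⟩
      · rintro ⟨w, rfl⟩
        exact ⟨w, w.2, rfl⟩
    have hr : B.subtype.toAddMonoidHom.range = (Subalgebra.toSubmodule V).toAddSubgroup :=
      AddSubgroup.ext fun x => ⟨by rintro ⟨w, rfl⟩; exact w.2, fun hx => ⟨⟨x, hx⟩, rfl⟩⟩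
    rw [← hr, ← AddSubgroup.index_comap, hr, e] at h
    exact Nat.finite_of_card_ne_zero h
  have hnoeth : IsNoetherianRing B := by
    refine ⟨fun I => ?_⟩
    by_cases hI : I = ⊥
    · rw [hI]; exact Submodule.fg_bot
    obtain ⟨b, hb, hb0⟩ := Submodule.exists_mem_ne_zero_of_ne_bot hI
    have := hfin b hb0
    have hle : Ideal.span {b} ≤ I := (Ideal.span_singleton_le_iff_mem I).mpr hb
    -- I is an extension of a subset of the finite ring B/bB by the cyclic module bB.
    refine Submodule.fg_of_fg_map_of_fg_inf_ker (Ideal.span {b}).mkQ ?_ ?_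
    · have : Finite (I.map (Ideal.span {b}).mkQ) := Subtype.finite
      exact Module.Finite.iff_fg.mp inferInstance
    · rw [Submodule.ker_mkQ, inf_eq_right.mpr hle]
      exact Submodule.fg_span_singleton _
  have hyB : y ∈ B := B.nonunits_le hy
  have hyM : (⟨y, hyB⟩ : B) ∈ IsLocalRing.maximalIdeal B := by
    have hy' : y ∈ (B.nonunits : Set K) := hy
    rw [← ValuationSubring.image_maximalIdeal] at hy'
    obtain ⟨w, hw, rfl⟩ := hy'
    exact hw
  have hnf : ¬ IsField B := by
    rw [IsLocalRing.isField_iff_maximalIdeal_eq]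
    intro h
    rw [h, Ideal.mem_bot] at hyM
    exact hy0 (congrArg Subtype.val hyM)
  have : IsDiscreteValuationRing B :=
    ((IsDiscreteValuationRing.TFAE B hnf).out 1 0 :
      ValuationRing B ↔ IsDiscreteValuationRing B).mp inferInstance
  let M := IsDiscreteValuationRing.maximalIdeal B
  refine ⟨⟨M.valuation K, ?_, ?_⟩, ?_⟩
  · intro γ
    by_cases hγ : γ = 0
    · exact ⟨0, by simp [hγ]⟩
    obtain ⟨π, hπ⟩ := M.valuation_exists_uniformizer K
    refine ⟨π ^ (-WithZero.log γ), ?_⟩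
    rw [map_zpow₀, hπ, ← WithZero.exp_zsmul]
    simp [WithZero.exp_log hγ]
  · intro c hc
    have hle : ∀ c : k, M.valuation K (algebraMap k K c) ≤ 1 := fun c =>
      M.valuation_le_one (K := K) (⟨algebraMap k K c, hk c⟩ : B)
    refine le_antisymm (hle c) ?_
    have h := hle c⁻¹
    rw [map_inv₀, map_inv₀] at h
    exact (inv_le_one₀ (zero_lt_iff.mpr (by simpa using hc))).mp h
  · exact (M.valuation_lt_one_iff_mem (K := K) (⟨y, hyB⟩ : B)).mpr hyM

/-- A transcendental y is not a unit of k[y], so the ideal (y) is proper and lies in the nonunits of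
some valuation ring of K containing k[y]. -/
theorem exists_place_val_lt_one [Finite k] [IsFunctionFieldOfConst k K] {y : K}
    (hy : Transcendental k y) : ∃ P : Place k K, P.val y < 1 := by
  let A := (Algebra.adjoin k {y}).toSubring
  let y' : A := ⟨y, Algebra.self_mem_adjoin_singleton k y⟩
  have hy0 : y ≠ 0 := fun h => hy (h ▸ isAlgebraic_zero)
  have hI : Ideal.span {y'} ≠ ⊤ := by
    intro h
    obtain ⟨w, hw⟩ := isUnit_iff_exists_inv.mp (Ideal.span_singleton_eq_top.mp h)
    obtain ⟨p, hp⟩ : ∃ p : Polynomial k, Polynomial.aeval y p = (w : K) := by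
      have := w.2
      change (w : K) ∈ Algebra.adjoin k {y} at this
      rw [Algebra.adjoin_singleton_eq_range_aeval] at this
      exact this
    have hw' : y * (w : K) = 1 := congrArg Subtype.val hw
    have : Polynomial.X * p - 1 = 0 := by
      by_contra hne
      exact hy ⟨_, hne, by simp [hp, hw']⟩
    have h0 := congrArg (Polynomial.eval 0) this
    simp at h0
  obtain ⟨B, hAB, hB⟩ := Ideal.image_subset_nonunits_valuationSubring _ hI
  exact B.exists_place (fun c => hAB ((Algebra.adjoin k {y}).algebraMap_mem c)) hy0
    (hB ⟨y', Ideal.mem_span_singleton_self y', rfl⟩)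

end Places

/-! ### Weak approximation -/

section Approximation

variable {k K : Type*} [Field k] [Field K] [Algebra k K]

theorem Place.ext_val {P Q : Place k K} (h : ∀ x, P.val x = Q.val x) : P = Q := by
  obtain ⟨v, _, _⟩ := P
  obtain ⟨w, _, _⟩ := Q
  obtain rfl : v = w := Valuation.ext h
  rfl

/-- Equal maximal ideals give equal unit groups, so Q is determined by P and by its value at a
uniformizer π of P. Surjectivity of Q forces that value to be `exp (-1)`. -/
theorem Place.eq_of_lt_one_iff {P Q : Place k K} (h : ∀ x, P.val x < 1 ↔ Q.val x < 1) : P = Q := by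
  have hone : ∀ x, P.val x = 1 ↔ Q.val x = 1 := by
    intro x
    by_cases h0 : x = 0
    · simp [h0]
    have h1 := h x
    have h2 := h x⁻¹
    simp only [map_inv₀, inv_lt_one₀ (zero_lt_iff.mpr ((map_ne_zero P.val).mpr h0)),
      inv_lt_one₀ (zero_lt_iff.mpr ((map_ne_zero Q.val).mpr h0))] at h2
    rw [← not_iff_not]
    change P.val x ≠ 1 ↔ Q.val x ≠ 1
    rw [ne_iff_lt_or_gt, ne_iff_lt_or_gt, h1]
    exact or_congr Iff.rfl h2
  obtain ⟨π, hπ0, hπ⟩ := P.exists_val_eq (-1)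
  have hQπ0 : Q.val π ≠ 0 := (map_ne_zero _).mpr hπ0
  have hpow : ∀ x, x ≠ 0 → Q.val x = Q.val π ^ (-WithZero.log (P.val x)) := by
    intro x hx
    have hPx : P.val x ≠ 0 := (map_ne_zero _).mpr hx
    have : P.val (x * π ^ (WithZero.log (P.val x))) = 1 := by
      rw [map_mul, map_zpow₀, hπ, ← WithZero.exp_zsmul]
      conv_lhs => rw [← WithZero.exp_log hPx]
      rw [← WithZero.exp_add]
      simp
    rw [hone, map_mul, map_zpow₀] at this
    rw [zpow_neg]
    exact eq_inv_of_mul_eq_one_left this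
  have hlt : Q.val π < 1 := (h π).mp (by rw [hπ, ← WithZero.exp_zero, WithZero.exp_lt_exp]; norm_num)
  obtain ⟨y, hy0, hy⟩ := Q.exists_val_eq (-1)
  have hQπ : Q.val π = WithZero.exp (-1) := by
    have h1 := hpow y hy0
    rw [hy, ← WithZero.exp_log hQπ0, ← WithZero.exp_zsmul, WithZero.exp_inj, smul_eq_mul] at h1
    rw [← WithZero.exp_log hQπ0, ← WithZero.exp_zero, WithZero.exp_lt_exp] at hlt
    rw [← WithZero.exp_log hQπ0, WithZero.exp_inj]
    have h2 : WithZero.log (Q.val π) ∣ 1 := by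
      rw [← dvd_neg, h1]
      exact dvd_mul_left _ _
    rcases Int.isUnit_iff.mp (isUnit_of_dvd_one h2) with h3 | h3 <;> omega
  refine Place.ext_val fun x => ?_
  by_cases hx : x = 0
  · simp [hx]
  · rw [hpow x hx, hQπ, ← WithZero.exp_zsmul]
    simp [WithZero.exp_log ((map_ne_zero P.val).mpr hx)]

/-- The real absolute value attached to a place. -/
noncomputable def Place.abs (P : Place k K) : AbsoluteValue K ℝ where
  toFun x := (WithZeroMulInt.toNNReal (e := 2) two_ne_zero (P.val x) : ℝ)
  map_mul' x y := by simp
  nonneg' x := NNReal.coe_nonneg _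
  eq_zero' x := by simp
  add_le' x y := by
    have hm := (WithZeroMulInt.toNNReal_strictMono (e := 2) one_lt_two).monotone
    have h := hm (P.val.map_add x y)
    rw [hm.map_max] at h
    exact_mod_cast h.trans (max_le (le_add_of_nonneg_right zero_le) (le_add_of_nonneg_left zero_le))

theorem Place.abs_apply (P : Place k K) (x : K) :
    P.abs x = (WithZeroMulInt.toNNReal (e := 2) two_ne_zero (P.val x) : ℝ) := rfl

theorem Place.abs_lt_iff (P : Place k K) (x : K) (γ : ℤᵐ⁰) :
    P.abs x < (WithZeroMulInt.toNNReal (e := 2) two_ne_zero γ : ℝ) ↔ P.val x < γ := by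
  rw [P.abs_apply, NNReal.coe_lt_coe, (WithZeroMulInt.toNNReal_strictMono (e := 2) one_lt_two).lt_iff_lt]

theorem Place.abs_lt_one_iff (P : Place k K) (x : K) : P.abs x < 1 ↔ P.val x < 1 := by
  simpa using P.abs_lt_iff x 1

/-- Weak approximation at finitely many places. -/
theorem exists_val_sub_le (S : Finset (Place k K)) (a : Place k K → K) (n : Place k K → ℤ) :
    ∃ x : K, ∀ P ∈ S, P.val (x - a P) ≤ WithZero.exp (n P) := by
  -- Density of K in a finite product holds for nontrivial, pairwise inequivalent absolute values. A
  -- uniformizer shows nontriviality; equivalent ones would have the same elements of value below 1,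
  -- hence come from the same place.
  have hdense := AbsoluteValue.denseRange_algebraMap_pi (v := fun P : S => P.1.abs)
    (fun P => by
      obtain ⟨π, hπ0, hπ⟩ := P.1.exists_val_eq (-1)
      refine ⟨π, hπ0, ((P.1.abs_lt_one_iff π).mpr ?_).ne⟩
      rw [hπ, ← WithZero.exp_zero, WithZero.exp_lt_exp]; norm_num)
    (fun P Q hPQ he => hPQ (Subtype.ext (Place.eq_of_lt_one_iff fun x => by
      rw [← Place.abs_lt_one_iff, ← Place.abs_lt_one_iff]
      exact he.lt_one_iff)))
  let U : Set (∀ P : S, WithAbs P.1.abs) := {f | ∀ P : S, ‖f P - WithAbs.toAbs _ (a P)‖ <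
    (WithZeroMulInt.toNNReal (e := 2) two_ne_zero (WithZero.exp (n P)) : ℝ)}
  have hU : IsOpen U := by
    simp only [U, Set.ofPred_forall]
    exact isOpen_iInter_of_finite fun P => isOpen_lt (by fun_prop) continuous_const
  obtain ⟨x, hx⟩ := hdense.exists_mem_open hU ⟨fun P => WithAbs.toAbs _ (a P), fun P => by
    rw [sub_self, norm_zero]
    exact_mod_cast WithZeroMulInt.toNNReal_pos two_ne_zero WithZero.exp_ne_zero⟩
  exact ⟨x, fun P hP => ((P.abs_lt_iff _ _).mp (hx ⟨P, hP⟩)).le⟩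

end Approximation

/-! ### Indices of lattices and norms of divisors -/

section Indices

variable {k K : Type*} [Field k] [Field K] [Algebra k K]

namespace Place

/-- The fractional ideal `{x | ν_P x + n ≥ 0}`. -/
def ball (P : Place k K) (n : ℤ) : AddSubgroup K where
  carrier := {x | P.val x ≤ WithZero.exp n}
  zero_mem' := by simp
  add_mem' hx hy := (P.val.map_add _ _).trans (max_le hx hy)
  neg_mem' {x} hx := by
    change P.val (-x) ≤ _
    rw [Valuation.map_neg]
    exact hx

theorem mem_ball (P : Place k K) {n : ℤ} {x : K} : x ∈ P.ball n ↔ P.val x ≤ WithZero.exp n := Iff.rfl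

theorem ball_mono (P : Place k K) {m n : ℤ} (h : m ≤ n) : P.ball m ≤ P.ball n :=
  fun _ hx => le_trans hx (WithZero.exp_le_exp.mpr h)

theorem map_mulLeft_ball (P : Place k K) {x : K} (hx : x ≠ 0) (n : ℤ) :
    (P.ball n).map (AddMonoidHom.mulLeft x) = P.ball (n + WithZero.log (P.val x)) := by
  have hPx : P.val x ≠ 0 := (map_ne_zero _).mpr hx
  ext y
  simp only [AddSubgroup.mem_map, mem_ball, AddMonoidHom.coe_mulLeft, WithZero.exp_add,
    WithZero.exp_log hPx]
  constructor
  · rintro ⟨w, hw, rfl⟩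
    rw [map_mul, mul_comm]
    gcongr
  · intro hy
    refine ⟨x⁻¹ * y, ?_, by field_simp⟩
    rw [map_mul, map_inv₀]
    calc (P.val x)⁻¹ * P.val y ≤ (P.val x)⁻¹ * (WithZero.exp n * P.val x) := by gcongr
      _ = WithZero.exp n := by field_simp

/-- The number of elements of the residue field of `P`. -/
noncomputable def resCard (P : Place k K) : ℕ := (P.ball (-1)).relIndex (P.ball 0)

theorem relIndex_ball_succ (P : Place k K) (n : ℤ) :
    (P.ball n).relIndex (P.ball (n + 1)) = P.resCard := by
  -- Multiplication by x carries the pair of balls with exponents -1, 0 to the pair n, n + 1.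
  obtain ⟨x, hx0, hx⟩ := P.exists_val_eq (n + 1)
  have h := AddSubgroup.relIndex_map_map_of_injective (P.ball (-1)) (P.ball 0)
    (f := AddMonoidHom.mulLeft x) (mul_right_injective₀ hx0)
  rw [P.map_mulLeft_ball hx0, P.map_mulLeft_ball hx0, hx, WithZero.log_exp] at h
  rw [resCard, ← h]
  congr 2 <;> ring

theorem relIndex_ball_add (P : Place k K) (m : ℤ) (n : ℕ) :
    (P.ball m).relIndex (P.ball (m + n)) = P.resCard ^ n := by
  induction n with
  | zero => simp
  | succ n ih =>
    rw [← AddSubgroup.relIndex_mul_relIndex (P.ball m) (P.ball (m + n)) _ (P.ball_mono (by simp))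
      (P.ball_mono (by simp)), ih, pow_succ, ← P.relIndex_ball_succ (m + n)]
    congr 3
    push_cast; ring

theorem resCard_ne_zero [Finite k] [IsFunctionFieldOfConst k K] (P : Place k K) : P.resCard ≠ 0 := by
  obtain ⟨z, hz0, hz⟩ := P.exists_val_eq (-1)
  have hz1 : P.val z < 1 := by rw [hz, ← WithZero.exp_zero, WithZero.exp_lt_exp]; norm_num
  have := IsFunctionFieldOfConst.finite_adjoin _ (P.transcendental_of_val_lt_one hz0 hz1)
  let V : Submodule k K :=
    { P.ball 0 with smul_mem' := fun c x hx => (P.val_smul_le c x).trans hx }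
  have h := (relIndex_map_mulLeft V hz0 (fun x hx => by
    change P.val (z * x) ≤ _
    rw [map_mul]
    exact mul_le_of_le_one_of_le hz1.le hx)).1
  have hV : V.toAddSubgroup = P.ball 0 := rfl
  rwa [hV, P.map_mulLeft_ball hz0, hz, WithZero.log_exp, zero_add] at h

theorem two_le_resCard [Finite k] [IsFunctionFieldOfConst k K] (P : Place k K) : 2 ≤ P.resCard := by
  have h1 : P.resCard ≠ 1 := by
    intro h
    have : (1 : K) ∈ P.ball (-1) := AddSubgroup.relIndex_eq_one.mp h (by simp [mem_ball])
    rw [mem_ball, map_one, ← WithZero.exp_zero, WithZero.exp_le_exp] at this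
    norm_num at this
  have := P.resCard_ne_zero
  omega

end Place

/-- All families `(a_P)` with `ν_P (a_P) + D P ≥ 0` at every place. -/
def adelicSpace (D : WeilDivisor k K) : AddSubgroup (Place k K → K) :=
  AddSubgroup.pi Set.univ fun P => P.ball (D P)

theorem mem_adelicSpace {D : WeilDivisor k K} {a : Place k K → K} :
    a ∈ adelicSpace D ↔ ∀ P, P.val (a P) ≤ WithZero.exp (D P) := by
  simp [adelicSpace, AddSubgroup.mem_pi, Place.mem_ball]

theorem adelicSpace_le_iff {D E : WeilDivisor k K} : adelicSpace D ≤ adelicSpace E ↔ D ≤ E := by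
  classical
  constructor
  · intro h P
    obtain ⟨x, -, hx⟩ := P.exists_val_eq (D P)
    have := mem_adelicSpace.mp (h (x := Pi.single P x) (mem_adelicSpace.mpr fun Q => by
      by_cases hQ : Q = P
      · subst hQ; simp [hx]
      · simp [hQ])) P
    rwa [Pi.single_eq_same, hx, WithZero.exp_le_exp] at this
  · exact fun h a ha => mem_adelicSpace.mpr fun P =>
      (mem_adelicSpace.mp ha P).trans (WithZero.exp_le_exp.mpr (h P))

/-- The norm `q ^ deg D` of a divisor. -/
noncomputable def divisorNorm (D : WeilDivisor k K) : ℚ := D.prod fun P n => (P.resCard : ℚ) ^ n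

theorem divisorNorm_zero : divisorNorm (0 : WeilDivisor k K) = 1 := Finsupp.prod_zero_index

theorem divisorNorm_single (P : Place k K) (n : ℤ) :
    divisorNorm (Finsupp.single P n) = (P.resCard : ℚ) ^ n :=
  Finsupp.prod_single_index (zpow_zero _)

theorem relIndex_adelicSpace_add_single (D : WeilDivisor k K) (P : Place k K) (n : ℕ) :
    (adelicSpace D).relIndex (adelicSpace (D + Finsupp.single P (n : ℤ))) = P.resCard ^ n := by
  classical
  set E := D + Finsupp.single P (n : ℤ) with hE
  have hinf : adelicSpace D
      = (P.ball (D P)).comap (Pi.evalAddMonoidHom (fun _ => K) P) ⊓ adelicSpace E := by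
    ext a
    simp only [AddSubgroup.mem_inf, AddSubgroup.mem_comap, mem_adelicSpace, Place.mem_ball,
      Pi.evalAddMonoidHom_apply]
    constructor
    · intro h
      exact ⟨h P, fun Q => (h Q).trans (WithZero.exp_le_exp.mpr (by
        by_cases hQ : P = Q <;> simp [hE, hQ]))⟩
    · rintro ⟨h1, h2⟩ Q
      by_cases hQ : P = Q
      · exact hQ ▸ h1
      · simpa [hE, Finsupp.single_apply, hQ] using h2 Q
  have hmap : (adelicSpace E).map (Pi.evalAddMonoidHom (fun _ => K) P) = P.ball (D P + n) := by
    ext x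
    constructor
    · rintro ⟨a, ha, rfl⟩
      simpa [hE, Place.mem_ball] using mem_adelicSpace.mp ha P
    · intro hx
      refine ⟨Pi.single P x, mem_adelicSpace.mpr fun Q => ?_, by simp⟩
      by_cases hQ : Q = P
      · subst hQ; simpa [hE, Place.mem_ball] using hx
      · simp [hQ]
  rw [hinf, AddSubgroup.inf_relIndex_right, AddSubgroup.relIndex_comap, hmap, P.relIndex_ball_add]

variable [Finite k] [IsFunctionFieldOfConst k K]

theorem divisorNorm_add (D E : WeilDivisor k K) :
    divisorNorm (D + E) = divisorNorm D * divisorNorm E :=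
  Finsupp.prod_add_index' (fun _ => zpow_zero _)
    fun P _ _ => zpow_add₀ (Nat.cast_ne_zero.mpr P.resCard_ne_zero) _ _

theorem divisorNorm_pos (D : WeilDivisor k K) : 0 < divisorNorm D :=
  Finset.prod_pos fun P _ => zpow_pos (Nat.cast_pos.mpr (Nat.pos_of_ne_zero P.resCard_ne_zero)) _

theorem divisorNorm_neg (D : WeilDivisor k K) : divisorNorm (-D) = (divisorNorm D)⁻¹ := by
  refine eq_inv_of_mul_eq_one_left ?_
  rw [← divisorNorm_add, neg_add_cancel, divisorNorm_zero]

theorem divisorNorm_nsmul (n : ℕ) (D : WeilDivisor k K) :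
    divisorNorm (n • D) = divisorNorm D ^ n := by
  induction n with
  | zero => simp [divisorNorm_zero]
  | succ n ih => rw [succ_nsmul, divisorNorm_add, ih, pow_succ]

/-- The multiplicative form of dim A(E)/A(D) = deg E - deg D, obtained by enlarging the divisor at
one place at a time. -/
theorem relIndex_adelicSpace {D E : WeilDivisor k K} (h : D ≤ E) :
    ((adelicSpace D).relIndex (adelicSpace E) : ℚ) * divisorNorm D = divisorNorm E := by
  have key : ∀ (G : Place k K →₀ ℕ) (D : WeilDivisor k K),
      ((adelicSpace D).relIndex (adelicSpace (D + G.mapRange Nat.cast Nat.cast_zero)) : ℚ)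
        * divisorNorm D = divisorNorm (D + G.mapRange Nat.cast Nat.cast_zero) := by
    intro G
    induction G using Finsupp.induction with
    | zero => intro D; simp
    | single_add P n G _ _ ih =>
      intro D
      have e : D + (Finsupp.single P n + G).mapRange Nat.cast Nat.cast_zero
          = (D + Finsupp.single P (n : ℤ)) + G.mapRange Nat.cast Nat.cast_zero := by
        rw [Finsupp.mapRange_add Nat.cast_add, Finsupp.mapRange_single, add_assoc]
      have hnn : (0 : WeilDivisor k K) ≤ G.mapRange Nat.cast Nat.cast_zero := fun Q => by simp
      rw [e, ← ih, ← AddSubgroup.relIndex_mul_relIndex (adelicSpace D)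
        (adelicSpace (D + Finsupp.single P (n : ℤ))) _ (adelicSpace_le_iff.mpr ?_)
        (adelicSpace_le_iff.mpr (le_add_of_nonneg_right hnn)), relIndex_adelicSpace_add_single,
        divisorNorm_add, divisorNorm_single]
      · push_cast
        rw [zpow_natCast]
        ring
      · exact le_add_of_nonneg_right (Finsupp.single_nonneg.mpr (by simp))
  have e : E = D + ((E - D).mapRange Int.toNat rfl).mapRange Nat.cast Nat.cast_zero := by
    ext P
    have := h P
    simp only [Finsupp.coe_add, Pi.add_apply, Finsupp.mapRange_apply, Finsupp.coe_sub, Pi.sub_apply]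
    omega
  rw [e]
  exact key _ _

theorem relIndex_adelicSpace_ne_zero {D E : WeilDivisor k K} (h : D ≤ E) :
    (adelicSpace D).relIndex (adelicSpace E) ≠ 0 := by
  intro h0
  have := relIndex_adelicSpace h
  rw [h0, Nat.cast_zero, zero_mul] at this
  exact (divisorNorm_pos E).ne this

end Indices

/-! ### Zeros, poles and principal divisors -/

section PrincipalDivisors

variable {k K : Type*} [Field k] [Field K] [Algebra k K]

theorem divisorNorm_sum [Finite k] [IsFunctionFieldOfConst k K] {ι : Type*} (s : Finset ι)
    (D : ι → WeilDivisor k K) : divisorNorm (∑ i ∈ s, D i) = ∏ i ∈ s, divisorNorm (D i) := by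
  classical
  induction s using Finset.induction_on with
  | empty => simp [divisorNorm_zero]
  | insert i s hi ih => rw [Finset.sum_insert hi, Finset.prod_insert hi, divisorNorm_add, ih]

theorem sum_single_apply [DecidableEq (Place k K)] (S : Finset (Place k K)) (f : Place k K → ℤ)
    (Q : Place k K) :
    (∑ P ∈ S, Finsupp.single P (f P)) Q = if Q ∈ S then f Q else 0 := by
  rw [Finsupp.finsetSum_apply]
  simp [Finsupp.single_apply]

/-- Let V be the ring of functions integral on S, and let -D be the part over S of the zero divisor
of z. Weak approximation gives V/zV ≅ A(0)/A(D), which has N(-D) elements; the left side has at most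
q^[K:k(z)]. -/
theorem divisorNorm_sum_single_le [Finite k] [IsFunctionFieldOfConst k K] {z : K}
    (hz : Transcendental k z) (S : Finset (Place k K)) (hS : ∀ P ∈ S, P.val z ≤ 1) :
    divisorNorm (∑ P ∈ S, Finsupp.single P (-WithZero.log (P.val z))) ≤
      (Nat.card k : ℚ) ^ Module.finrank (IntermediateField.adjoin k {z}) K := by
  classical
  have hz0 : z ≠ 0 := fun h => hz (h ▸ isAlgebraic_zero)
  have hPz : ∀ P : Place k K, P.val z ≠ 0 := fun P => (map_ne_zero _).mpr hz0
  have := IsFunctionFieldOfConst.finite_adjoin _ hz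
  set D : WeilDivisor k K := ∑ P ∈ S, Finsupp.single P (WithZero.log (P.val z)) with hD
  have hDapp : ∀ Q, D Q = if Q ∈ S then WithZero.log (Q.val z) else 0 :=
    sum_single_apply S _
  have hDexp : ∀ P ∈ S, WithZero.exp (D P) = P.val z := fun P hP => by
    rw [hDapp, if_pos hP, WithZero.exp_log (hPz P)]
  have hD0 : D ≤ 0 := fun Q => by
    rw [hDapp]
    split_ifs with h
    · rw [Finsupp.coe_zero, Pi.zero_apply, WithZero.log_le_iff_le_exp (hPz Q)]
      exact hS Q h
    · rfl
  have hneg : (∑ P ∈ S, Finsupp.single P (-WithZero.log (P.val z))) = -D := by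
    simp [hD, Finsupp.single_neg]
  let V : Submodule k K :=
    { carrier := {x | ∀ P ∈ S, P.val x ≤ 1}
      zero_mem' := fun P _ => by simp
      add_mem' := fun hx hy P hP => (P.val.map_add _ _).trans (max_le (hx P hP) (hy P hP))
      smul_mem' := fun c x hx P hP => (P.val_smul_le c x).trans (hx P hP) }
  -- The diagonal on S, extended by 0 so that places outside S impose no condition.
  let φ : K →+ (Place k K → K) := AddMonoidHom.mk' (fun x P => if P ∈ S then x else 0)
    (fun x y => by ext P; by_cases hP : P ∈ S <;> simp [hP])
  have hφ : ∀ x P, φ x P = if P ∈ S then x else 0 := fun _ _ => rfl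
  have hcomap : (adelicSpace D).comap φ = V.toAddSubgroup.map (AddMonoidHom.mulLeft z) := by
    ext x
    rw [AddSubgroup.mem_comap, mem_adelicSpace]
    constructor
    · intro h
      refine ⟨z⁻¹ * x, fun P hP => ?_, by simp [hz0]⟩
      have := h P
      rw [hφ, if_pos hP, hDexp P hP] at this
      rw [map_mul, map_inv₀]
      exact inv_mul_le_one_of_le₀ this zero_le
    · rintro ⟨y, hy, rfl⟩ P
      rw [hφ]
      split_ifs with hP
      · rw [hDexp P hP]
        simpa using mul_le_of_le_one_right' (hy P hP)
      · simp
  -- Surjectivity of V → A(0)/A(D): an approximation modulo D on S of an integral family is itself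
  -- integral on S.
  have hsup : V.toAddSubgroup.map φ ⊔ adelicSpace D = adelicSpace 0 := by
    refine le_antisymm (sup_le ?_ (adelicSpace_le_iff.mpr hD0)) fun a ha => ?_
    · rintro _ ⟨x, hx, rfl⟩
      refine mem_adelicSpace.mpr fun P => ?_
      rw [hφ]
      split_ifs with hP
      · exact hx P hP
      · simp
    · rw [mem_adelicSpace] at ha
      obtain ⟨x, hx⟩ := exists_val_sub_le S a D
      have hxV : x ∈ V.toAddSubgroup := fun P hP => by
        rw [show x = (x - a P) + a P by ring]
        refine (P.val.map_add _ _).trans (max_le ?_ (ha P))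
        exact (hx P hP).trans (by rw [hDexp P hP]; exact hS P hP)
      rw [show a = φ x + (a - φ x) by ring]
      refine AddSubgroup.add_mem_sup (AddSubgroup.mem_map_of_mem φ hxV)
        (mem_adelicSpace.mpr fun P => ?_)
      rw [Pi.sub_apply, hφ]
      split_ifs with hP
      · rw [Valuation.map_sub_swap]; exact hx P hP
      · rw [sub_zero, hDapp, if_neg hP]; exact ha P
  have hidx := (relIndex_map_mulLeft V hz0 (fun x hx P hP => by
    rw [map_mul]; exact mul_le_one' (hS P hP) (hx P hP))).2
  rw [← hcomap, AddSubgroup.relIndex_comap, ← AddSubgroup.relIndex_sup_right, hsup] at hidx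
  have hn := relIndex_adelicSpace hD0
  rw [divisorNorm_zero] at hn
  rw [hneg, divisorNorm_neg, ← eq_inv_of_mul_eq_one_left hn]
  exact_mod_cast hidx

variable (k) in
-- Each zero of z multiplies the norm by at least 2, and the norm is at most M = q^[K:k(z)]. Having
-- M zeros would give 2^M ≤ M.
theorem finite_setOf_val_lt_one [Finite k] [IsFunctionFieldOfConst k K] {z : K} (hz0 : z ≠ 0) :
    {P : Place k K | P.val z < 1}.Finite := by
  by_cases hz : Transcendental k z
  swap
  · convert Set.finite_empty
    ext P
    exact iff_of_false (fun h => hz (P.transcendental_of_val_lt_one hz0 h)) id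
  by_contra hinf
  obtain ⟨S, hS, hcard⟩ := Set.Infinite.exists_subset_card_eq hinf
    (Nat.card k ^ Module.finrank (IntermediateField.adjoin k {z}) K)
  have h1 := divisorNorm_sum_single_le hz S fun P hP => (hS hP).le
  have h2 : (2 : ℚ) ^ S.card ≤ divisorNorm (∑ P ∈ S, Finsupp.single P (-WithZero.log (P.val z))) := by
    rw [divisorNorm_sum, ← Finset.prod_const]
    refine Finset.prod_le_prod (fun _ _ => by norm_num) fun P hP => ?_
    have hPz : P.val z ≠ 0 := (map_ne_zero _).mpr hz0
    have hlog : WithZero.log (P.val z) < 0 := by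
      rw [WithZero.log_lt_iff_lt_exp hPz]; exact hS hP
    have hc : (2 : ℚ) ≤ P.resCard := by exact_mod_cast P.two_le_resCard
    rw [divisorNorm_single]
    calc (2 : ℚ) ≤ (P.resCard : ℚ) ^ (1 : ℤ) := by rwa [zpow_one]
      _ ≤ _ := zpow_le_zpow_right₀ (by linarith) (by omega)
  rw [hcard] at h2
  have h3 := h2.trans h1
  have h4 := Nat.lt_two_pow_self
    (n := Nat.card k ^ Module.finrank (IntermediateField.adjoin k {z}) K)
  have h5 : 2 ^ (Nat.card k ^ Module.finrank (IntermediateField.adjoin k {z}) K) ≤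
    Nat.card k ^ Module.finrank (IntermediateField.adjoin k {z}) K := by exact_mod_cast h3
  omega

variable [Finite k] [IsFunctionFieldOfConst k K]

variable (k) in
theorem finite_support_log_val (x : K) :
    (Function.support fun P : Place k K => -WithZero.log (P.val x)).Finite := by
  by_cases hx : x = 0
  · simp [hx]
  refine ((finite_setOf_val_lt_one k hx).union
    (finite_setOf_val_lt_one k (inv_ne_zero hx))).subset fun P hP => ?_
  have hPx : P.val x ≠ 0 := (map_ne_zero _).mpr hx
  rw [Function.mem_support, neg_ne_zero] at hP
  have h1 : P.val x ≠ 1 := fun h => hP (by rw [h, WithZero.log_one])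
  rcases lt_or_gt_of_ne h1 with h | h
  · exact Or.inl h
  · refine Or.inr ?_
    change P.val x⁻¹ < 1
    rw [map_inv₀]
    exact inv_lt_one_of_one_lt₀ h

variable (k) in
/-- The divisor of `x`, equal to `0` for `x = 0`. -/
noncomputable def principalDivisor (x : K) : WeilDivisor k K :=
  Finsupp.ofSupportFinite (fun P => -WithZero.log (P.val x)) (finite_support_log_val k x)

theorem principalDivisor_apply (x : K) (P : Place k K) :
    principalDivisor k x P = -WithZero.log (P.val x) := rfl

theorem val_eq_exp_neg (P : Place k K) {x : K} (hx : x ≠ 0) :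
    P.val x = WithZero.exp (-principalDivisor k x P) := by
  rw [principalDivisor_apply, neg_neg, WithZero.exp_log ((map_ne_zero _).mpr hx)]

theorem principalDivisor_inv (x : K) : principalDivisor k x⁻¹ = -principalDivisor k x := by
  ext P
  simp [principalDivisor_apply, WithZero.log_inv]

theorem principalDivisor_mul {x y : K} (hx : x ≠ 0) (hy : y ≠ 0) :
    principalDivisor k (x * y) = principalDivisor k x + principalDivisor k y := by
  ext P
  simp [principalDivisor_apply, WithZero.log_mul ((map_ne_zero P.val).mpr hx)
    ((map_ne_zero P.val).mpr hy)]
  ring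

theorem eventually_val_le_one (x : K) : ∀ᶠ P : Place k K in Filter.cofinite, P.val x ≤ 1 := by
  by_cases hx : x = 0
  · simp [hx]
  refine (finite_support_log_val k x).subset fun P hP => ?_
  rw [Function.mem_support, neg_ne_zero]
  intro h
  refine hP ?_
  change P.val x ≤ 1
  rw [← WithZero.exp_log ((map_ne_zero P.val).mpr hx), h, WithZero.exp_zero]

variable (k) in
/-- The divisor of poles of `x`. -/
noncomputable def poleDivisor (x : K) : WeilDivisor k K := (-principalDivisor k x) ⊔ 0

theorem poleDivisor_nonneg (x : K) : 0 ≤ poleDivisor k x := le_sup_right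

theorem val_le_exp_poleDivisor (P : Place k K) (x : K) :
    P.val x ≤ WithZero.exp (poleDivisor k x P) := by
  by_cases hx : x = 0
  · simp [hx]
  rw [val_eq_exp_neg P hx, WithZero.exp_le_exp]
  exact (le_sup_left : -principalDivisor k x ≤ poleDivisor k x) P

theorem principalDivisor_eq_sub (x : K) :
    principalDivisor k x = poleDivisor k x⁻¹ - poleDivisor k x := by
  ext P
  simp only [poleDivisor, principalDivisor_inv, neg_neg, Finsupp.coe_sub, Pi.sub_apply,
    Finsupp.sup_apply, Finsupp.coe_neg, Pi.neg_apply, Finsupp.coe_zero, Pi.zero_apply]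
  omega

/-- The poles of z⁻¹ are the zeros of z; the bound is applied with S the set of all zeros. -/
theorem divisorNorm_poleDivisor_inv_le {z : K} (hz : Transcendental k z) :
    divisorNorm (poleDivisor k z⁻¹) ≤
      (Nat.card k : ℚ) ^ Module.finrank (IntermediateField.adjoin k {z}) K := by
  classical
  have hz0 : z ≠ 0 := fun h => hz (h ▸ isAlgebraic_zero)
  let S := (finite_setOf_val_lt_one k hz0).toFinset
  have hS : ∀ P, P ∈ S ↔ P.val z < 1 := fun P => Set.Finite.mem_toFinset _
  convert divisorNorm_sum_single_le hz S fun P hP => ((hS P).mp hP).le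
  ext P
  rw [sum_single_apply]
  simp only [hS]
  have := WithZero.log_lt_iff_lt_exp ((map_ne_zero P.val).mpr hz0) (a := (0 : ℤ))
  rw [WithZero.exp_zero] at this
  simp only [poleDivisor, principalDivisor_inv, neg_neg, Finsupp.sup_apply, Finsupp.coe_zero,
    Pi.zero_apply, principalDivisor_apply, ← this]
  split_ifs <;> omega

end PrincipalDivisors

/-! ### Riemann–Roch spaces, and degree zero of principal divisors -/

section RiemannRochSpaces

variable {k K : Type*} [Field k] [Field K] [Algebra k K]

theorem riemannRochSpace_mono {D E : WeilDivisor k K} (h : D ≤ E) :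
    riemannRochSpace k K D ≤ riemannRochSpace k K E :=
  fun _ hx P => (hx P).trans (WithZero.exp_le_exp.mpr (h P))

variable (k K) in
/-- The diagonal embedding of `K`. -/
def diagonalHom : K →+ (Place k K → K) := AddMonoidHom.mk' (fun x _ => x) fun _ _ => rfl

theorem diagonalHom_apply (x : K) (P : Place k K) : diagonalHom k K x P = x := rfl

theorem comap_diagonalHom (D : WeilDivisor k K) :
    (adelicSpace D).comap (diagonalHom k K) = (riemannRochSpace k K D).toAddSubgroup := by
  ext x
  exact mem_adelicSpace

theorem map_diagonalHom (D : WeilDivisor k K) :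
    (riemannRochSpace k K D).toAddSubgroup.map (diagonalHom k K)
      = (diagonalHom k K).range ⊓ adelicSpace D := by
  rw [← comap_diagonalHom, AddSubgroup.map_comap_eq]

/-- Counts the exact sequence 0 → L(E)/L(D) → A(E)/A(D) → (A(E)+K)/(A(D)+K) → 0; the modular law
identifies the kernel. -/
theorem relIndex_riemannRochSpace_mul {D E : WeilDivisor k K} (h : D ≤ E) :
    (riemannRochSpace k K D).toAddSubgroup.relIndex (riemannRochSpace k K E).toAddSubgroup *
      (adelicSpace D ⊔ (diagonalHom k K).range).relIndex (adelicSpace E ⊔ (diagonalHom k K).range)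
      = (adelicSpace D).relIndex (adelicSpace E) := by
  set Δ := (diagonalHom k K).range
  have hle := adelicSpace_le_iff.mpr h
  have h1 : (adelicSpace D ⊔ Δ).relIndex (adelicSpace E ⊔ Δ)
      = (adelicSpace D ⊔ Δ).relIndex (adelicSpace E) := by
    rw [← AddSubgroup.relIndex_sup_right (adelicSpace E) (adelicSpace D ⊔ Δ), ← sup_assoc,
      sup_eq_left.mpr hle]
  have h2 : (riemannRochSpace k K D).toAddSubgroup.relIndex (riemannRochSpace k K E).toAddSubgroup
      = (adelicSpace D).relIndex (adelicSpace D ⊔ Δ ⊓ adelicSpace E) := by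
    rw [← comap_diagonalHom D, AddSubgroup.relIndex_comap, map_diagonalHom,
      AddSubgroup.relIndex_sup_left]
  have h3 : adelicSpace D ⊔ Δ ⊓ adelicSpace E = (adelicSpace D ⊔ Δ) ⊓ adelicSpace E :=
    (sup_inf_assoc_of_le Δ hle).symm
  rw [h1, h2, h3, ← AddSubgroup.inf_relIndex_right (adelicSpace D ⊔ Δ) (adelicSpace E)]
  exact AddSubgroup.relIndex_mul_relIndex _ _ _ (le_inf le_sup_left hle) inf_le_right

theorem card_riemannRochSpace_mul {D E : WeilDivisor k K} (h : D ≤ E) :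
    Nat.card (riemannRochSpace k K D) *
      (riemannRochSpace k K D).toAddSubgroup.relIndex (riemannRochSpace k K E).toAddSubgroup
      = Nat.card (riemannRochSpace k K E) := by
  have := AddSubgroup.relIndex_mul_relIndex ⊥ (riemannRochSpace k K D).toAddSubgroup
    (riemannRochSpace k K E).toAddSubgroup bot_le (riemannRochSpace_mono h)
  rwa [AddSubgroup.relIndex_bot_left, AddSubgroup.relIndex_bot_left] at this

variable [Finite k] [IsFunctionFieldOfConst k K]

variable (k K) in
-- If x is not constant, a zero of x⁻¹ is a pole of x.
theorem riemannRochSpace_zero (x : K) :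
    x ∈ riemannRochSpace k K 0 ↔ x ∈ (algebraMap k K).range := by
  constructor
  · intro hx
    by_contra h
    have htr : Transcendental k x := fun halg => h (IsFunctionFieldOfConst.mem_range x halg)
    have htr' : Transcendental k x⁻¹ := fun halg => htr (by simpa using halg.inv)
    have hx0 : x ≠ 0 := by rintro rfl; exact htr isAlgebraic_zero
    obtain ⟨P, hP⟩ := exists_place_val_lt_one htr'
    rw [map_inv₀, inv_lt_one₀ (zero_lt_iff.mpr ((map_ne_zero _).mpr hx0))] at hP
    exact hP.not_ge (hx P)
  · rintro ⟨c, rfl⟩ P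
    exact P.val_const_le c

variable (k K) in
theorem card_riemannRochSpace_zero : Nat.card (riemannRochSpace k K 0) = Nat.card k := by
  refine (Nat.card_congr (Equiv.ofBijective
    (fun c : k => (⟨algebraMap k K c, (riemannRochSpace_zero k K _).mpr ⟨c, rfl⟩⟩ :
      riemannRochSpace k K 0)) ⟨fun a b h => ?_, fun x => ?_⟩)).symm
  · exact (algebraMap k K).injective (congrArg Subtype.val h)
  · obtain ⟨c, hc⟩ := (riemannRochSpace_zero k K _).mp x.2
    exact ⟨c, Subtype.ext hc⟩

instance (D : WeilDivisor k K) : Finite (riemannRochSpace k K D) := by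
  -- `Nat.card` is 0 on infinite types, so nonvanishing is finiteness. L(0) is finite, and its index
  -- in L(D ⊔ 0) is a factor of a nonzero adelic index.
  have h0 : Nat.card (riemannRochSpace k K (D ⊔ 0)) ≠ 0 := by
    rw [← card_riemannRochSpace_mul (le_sup_right : (0 : WeilDivisor k K) ≤ D ⊔ 0),
      card_riemannRochSpace_zero]
    refine mul_ne_zero Nat.card_pos.ne' fun h => ?_
    have := relIndex_riemannRochSpace_mul (le_sup_right : (0 : WeilDivisor k K) ≤ D ⊔ 0)
    rw [h, zero_mul] at this
    exact relIndex_adelicSpace_ne_zero le_sup_right this.symm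
  have := Nat.finite_of_card_ne_zero h0
  exact Set.Finite.subset (s := (riemannRochSpace k K (D ⊔ 0) : Set K)) this
    (riemannRochSpace_mono le_sup_left)

theorem card_riemannRochSpace_le {E : WeilDivisor k K} (h : 0 ≤ E) :
    (Nat.card (riemannRochSpace k K E) : ℚ) ≤ Nat.card k * divisorNorm E := by
  have h1 := relIndex_adelicSpace h
  rw [divisorNorm_zero, mul_one, ← relIndex_riemannRochSpace_mul h] at h1
  rw [← card_riemannRochSpace_mul h, card_riemannRochSpace_zero, ← h1]
  have h2 : (adelicSpace 0 ⊔ (diagonalHom k K).range).relIndex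
      (adelicSpace E ⊔ (diagonalHom k K).range) ≠ 0 := by
    intro h0
    refine relIndex_adelicSpace_ne_zero h ?_
    rw [← relIndex_riemannRochSpace_mul h, h0, mul_zero]
  push_cast
  gcongr
  exact le_mul_of_one_le_right (by positivity) (by exact_mod_cast Nat.one_le_iff_ne_zero.mpr h2)

/-- C bounds the poles of a basis (b_i) of K over k(z). The products z^j b_i with j ≤ n are
k-independent and lie in L(C + n(z)_∞). -/
theorem exists_pow_le_card_riemannRochSpace {z : K} (hz : Transcendental k z) :
    ∃ C : WeilDivisor k K, 0 ≤ C ∧ ∀ n : ℕ,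
      Nat.card k ^ (Module.finrank (IntermediateField.adjoin k {z}) K * (n + 1)) ≤
        Nat.card (riemannRochSpace k K (C + n • poleDivisor k z)) := by
  have := IsFunctionFieldOfConst.finite_adjoin _ hz
  let b := Module.finBasis (IntermediateField.adjoin k {z}) K
  refine ⟨∑ i, poleDivisor k (b i), Finset.sum_nonneg fun i _ => poleDivisor_nonneg _, fun n => ?_⟩
  let g : IntermediateField.adjoin k {z} := IntermediateField.AdjoinSimple.gen k z
  have hpow : LinearIndependent k fun j : Fin (n + 1) => g ^ (j : ℕ) := by
    have h1 : LinearIndependent k fun j : Fin (n + 1) => z ^ (j : ℕ) := by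
      have h2 := ((Polynomial.basisMonomials k).linearIndependent.map'
        (Polynomial.aeval z).toLinearMap
        (LinearMap.ker_eq_bot.mpr (transcendental_iff_injective.mp hz))).comp
        (fun j : Fin (n + 1) => (j : ℕ)) Fin.val_injective
      have e : (⇑(Polynomial.aeval z).toLinearMap ∘ ⇑(Polynomial.basisMonomials k)) ∘
          (fun j : Fin (n + 1) => (j : ℕ)) = fun j : Fin (n + 1) => z ^ (j : ℕ) := by
        ext j
        simp
      rwa [e] at h2
    exact LinearIndependent.of_comp (IntermediateField.adjoin k {z}).val.toLinearMap h1
  have hlin := linearIndependent_smul hpow b.linearIndependent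
  have hmem : ∀ p : Fin (n + 1) × Fin (Module.finrank (IntermediateField.adjoin k {z}) K),
      g ^ (p.1 : ℕ) • b p.2 ∈
        riemannRochSpace k K (∑ i, poleDivisor k (b i) + n • poleDivisor k z) := by
    intro p P
    have e : g ^ (p.1 : ℕ) • b p.2 = z ^ (p.1 : ℕ) * b p.2 := rfl
    rw [e, map_mul, map_pow, Finsupp.add_apply, WithZero.exp_add, mul_comm]
    refine mul_le_mul' ((val_le_exp_poleDivisor P _).trans (WithZero.exp_le_exp.mpr ?_)) ?_
    · exact Finset.single_le_sum (f := fun i => poleDivisor k (b i))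
        (fun i _ => poleDivisor_nonneg _) (Finset.mem_univ p.2) P
    · calc P.val z ^ (p.1 : ℕ) ≤ WithZero.exp (poleDivisor k z P) ^ (p.1 : ℕ) :=
            pow_le_pow_left' (val_le_exp_poleDivisor P z) _
        _ ≤ WithZero.exp (poleDivisor k z P) ^ n := by
            refine pow_le_pow_right' ?_ (Nat.lt_succ_iff.mp p.1.2)
            rw [← WithZero.exp_zero, WithZero.exp_le_exp]
            exact poleDivisor_nonneg z P
        _ = _ := by rw [← WithZero.exp_nsmul]; simp
  have hlin' : LinearIndependent k fun p => (⟨_, hmem p⟩ :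
      riemannRochSpace k K (∑ i, poleDivisor k (b i) + n • poleDivisor k z)) :=
    LinearIndependent.of_comp (Submodule.subtype _) hlin
  have hcard := hlin'.fintype_card_le_finrank
  rw [Fintype.card_prod, Fintype.card_fin, Fintype.card_fin, mul_comm] at hcard
  rw [Module.natCard_eq_pow_finrank (K := k) (V := riemannRochSpace k K _)]
  exact Nat.pow_le_pow_right Nat.card_pos hcard

theorem pow_finrank_le_divisorNorm_poleDivisor {z : K} (hz : Transcendental k z) :
    (Nat.card k : ℚ) ^ Module.finrank (IntermediateField.adjoin k {z}) K ≤
      divisorNorm (poleDivisor k z) := by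
  obtain ⟨C, hC, h⟩ := exists_pow_le_card_riemannRochSpace hz
  set a : ℚ := (Nat.card k : ℚ) ^ Module.finrank (IntermediateField.adjoin k {z}) K with ha
  set b := divisorNorm (poleDivisor k z)
  have hb : 0 < b := divisorNorm_pos _
  -- The lower and upper counts of L(C + n(z)_∞). If b < a, the powers (a/b)^n would be unbounded.
  have hkey : ∀ n : ℕ, a ^ (n + 1) ≤ Nat.card k * divisorNorm C * b ^ n := fun n => by
    have h1 : (0 : WeilDivisor k K) ≤ C + n • poleDivisor k z :=
      add_nonneg hC (nsmul_nonneg (poleDivisor_nonneg z) n)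
    have h2 := card_riemannRochSpace_le h1
    rw [divisorNorm_add, divisorNorm_nsmul, ← mul_assoc] at h2
    refine le_trans ?_ h2
    rw [ha, ← pow_mul]
    exact_mod_cast h n
  by_contra! hlt
  obtain ⟨n, hn⟩ := pow_unbounded_of_one_lt (Nat.card k * divisorNorm C / a) ((one_lt_div hb).mpr hlt)
  have ha0 : 0 < a := hb.trans hlt
  rw [div_pow, div_lt_div_iff₀ ha0 (by positivity), ← pow_succ] at hn
  exact (hkey n).not_gt hn

theorem divisorNorm_poleDivisor {z : K} (hz : Transcendental k z) :
    divisorNorm (poleDivisor k z) =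
      (Nat.card k : ℚ) ^ Module.finrank (IntermediateField.adjoin k {z}) K := by
  refine le_antisymm ?_ (pow_finrank_le_divisorNorm_poleDivisor hz)
  have hz' : Transcendental k z⁻¹ := fun h => hz (by simpa using h.inv)
  have h := divisorNorm_poleDivisor_inv_le hz'
  have e : IntermediateField.adjoin k {z⁻¹} = IntermediateField.adjoin k {z} := by
    refine le_antisymm ?_ ?_ <;> rw [IntermediateField.adjoin_simple_le_iff]
    · exact inv_mem (IntermediateField.mem_adjoin_simple_self k z)
    · simpa using inv_mem (IntermediateField.mem_adjoin_simple_self k z⁻¹)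
  rwa [inv_inv, e] at h

theorem divisorNorm_principalDivisor (x : K) : divisorNorm (principalDivisor k x) = 1 := by
  by_cases hx : Transcendental k x
  · have hx' : Transcendental k x⁻¹ := fun h => hx (by simpa using h.inv)
    have h1 := divisorNorm_poleDivisor_inv_le hx
    have h2 := divisorNorm_poleDivisor_inv_le hx'
    have h3 := pow_finrank_le_divisorNorm_poleDivisor hx
    have h4 := pow_finrank_le_divisorNorm_poleDivisor hx'
    rw [inv_inv] at h2
    rw [principalDivisor_eq_sub, sub_eq_add_neg, divisorNorm_add, divisorNorm_neg]
    -- Zeros of x ≤ q^[K:k(x)] ≤ poles of x in norm, and the same for x⁻¹ gives the reverse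
    -- inequality.
    have : divisorNorm (poleDivisor k x⁻¹) = divisorNorm (poleDivisor k x) :=
      le_antisymm (h1.trans h3) (h2.trans h4)
    rw [this, mul_inv_cancel₀ (divisorNorm_pos _).ne']
  · obtain ⟨c, rfl⟩ := IsFunctionFieldOfConst.mem_range x (not_not.mp hx)
    have : principalDivisor k (algebraMap k K c) = 0 := by
      ext P
      rw [principalDivisor_apply]
      by_cases hc : c = 0
      · simp [hc]
      · simp [P.map_const c hc]
    rw [this, divisorNorm_zero]

end RiemannRochSpaces

/-! ### Riemann's inequality and the speciality index -/

section Riemann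

variable {k K : Type*} [Field k] [Field K] [Algebra k K]

theorem adelicSpace_le_repartitions (D : WeilDivisor k K) :
    adelicSpace D ≤ (repartitions k K).toAddSubgroup := by
  intro a ha
  refine D.hasFiniteSupport.subset fun P hP => ?_
  rw [Function.mem_support]
  intro h
  refine hP ?_
  have := mem_adelicSpace.mp ha P
  rwa [h, WithZero.exp_zero] at this

theorem exists_mem_adelicSpace {a : Place k K → K} (ha : a ∈ repartitions k K) :
    ∃ D : WeilDivisor k K, a ∈ adelicSpace D := by
  have hfin : (Function.support fun P : Place k K => WithZero.log (P.val (a P)) ⊔ 0).Finite := by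
    refine Set.Finite.subset (s := {P : Place k K | ¬ P.val (a P) ≤ 1}) ha fun P hP h => hP ?_
    by_cases h0 : P.val (a P) = 0
    · simp [h0]
    · have := (WithZero.log_le_iff_le_exp (a := (0 : ℤ)) h0).mpr (by simpa using h)
      simpa using this
  refine ⟨Finsupp.ofSupportFinite _ hfin, mem_adelicSpace.mpr fun P => ?_⟩
  rw [Finsupp.ofSupportFinite_coe]
  by_cases h0 : P.val (a P) = 0
  · simp [h0]
  · rw [← WithZero.log_le_iff_le_exp h0]
    exact le_sup_left

theorem sup_range_mono {D E : WeilDivisor k K} (h : D ≤ E) :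
    adelicSpace D ⊔ (diagonalHom k K).range ≤ adelicSpace E ⊔ (diagonalHom k K).range :=
  sup_le_sup_right (adelicSpace_le_iff.mpr h) _

variable [Finite k] [IsFunctionFieldOfConst k K]

theorem card_riemannRochSpace_add_principalDivisor (D : WeilDivisor k K) {x : K} (hx : x ≠ 0) :
    Nat.card (riemannRochSpace k K (D + principalDivisor k x)) =
      Nat.card (riemannRochSpace k K D) := by
  refine (Nat.card_congr ((Equiv.mulLeft₀ x⁻¹ (inv_ne_zero hx)).subtypeEquiv fun y => ?_)).symm
  refine forall_congr' fun P => ?_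
  have hPx : P.val x ≠ 0 := (map_ne_zero _).mpr hx
  change _ ↔ P.val (x⁻¹ * y) ≤ _
  rw [map_mul, map_inv₀, Finsupp.add_apply, WithZero.exp_add,
    principalDivisor_apply, WithZero.exp_neg, WithZero.exp_log hPx, mul_comm (WithZero.exp (D P)),
    mul_le_mul_iff_right₀ (zero_lt_iff.mpr (inv_ne_zero hPx))]

theorem relIndex_sup_range_ne_zero {D E : WeilDivisor k K} (h : D ≤ E) :
    (adelicSpace D ⊔ (diagonalHom k K).range).relIndex
      (adelicSpace E ⊔ (diagonalHom k K).range) ≠ 0 := by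
  intro h0
  refine relIndex_adelicSpace_ne_zero h ?_
  rw [← relIndex_riemannRochSpace_mul h, h0, mul_zero]

theorem card_mul_relIndex_mul_divisorNorm {D E : WeilDivisor k K} (h : D ≤ E) :
    (Nat.card (riemannRochSpace k K E) : ℚ) * (adelicSpace D ⊔ (diagonalHom k K).range).relIndex
      (adelicSpace E ⊔ (diagonalHom k K).range) * divisorNorm D =
      Nat.card (riemannRochSpace k K D) * divisorNorm E := by
  rw [← relIndex_adelicSpace h, ← relIndex_riemannRochSpace_mul h, ← card_riemannRochSpace_mul h]
  push_cast
  ring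

/-- A pole of t already occurs in (t)_∞. At any other P the powers of t are integral and the residue
field is finite, so two of them agree modulo P; their difference z vanishes at P and has poles only
at those of t. -/
theorem exists_single_le (t : K) (ht : Transcendental k t) (P : Place k K) :
    ∃ (n : ℕ) (z : K), z ≠ 0 ∧
      Finsupp.single P (1 : ℤ) ≤ n • poleDivisor k t + principalDivisor k z := by
  classical
  have hpole := poleDivisor_nonneg (k := k) t
  by_cases hP : P.val t ≤ 1
  · have hfin : Finite (P.ball 0 ⧸ (P.ball (-1)).addSubgroupOf (P.ball 0)) :=
      Nat.finite_of_card_ne_zero P.resCard_ne_zero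
    have hpow : ∀ i : ℕ, t ^ i ∈ P.ball 0 := fun i => by
      rw [Place.mem_ball, map_pow]
      exact pow_le_one' hP i
    obtain ⟨i, j, hij, h⟩ := Finite.exists_ne_map_eq_of_infinite
      (fun i : ℕ => (QuotientAddGroup.mk ⟨t ^ i, hpow i⟩ :
        P.ball 0 ⧸ (P.ball (-1)).addSubgroupOf (P.ball 0)))
    rw [QuotientAddGroup.eq, AddSubgroup.mem_addSubgroupOf] at h
    change -t ^ i + t ^ j ∈ P.ball (-1) at h
    have hz : -t ^ i + t ^ j ≠ 0 := by
      intro h0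
      refine ht ⟨-Polynomial.X ^ i + Polynomial.X ^ j, fun hp => hij ?_, by simpa using h0⟩
      have h1 : (Polynomial.X ^ i : Polynomial k) = Polynomial.X ^ j := by
        linear_combination -hp
      simpa using congrArg Polynomial.natDegree h1
    -- i + j is a crude bound for max i j, enough to control the poles of both powers.
    refine ⟨i + j, _, hz, fun Q => ?_⟩
    have hle : ∀ Q : Place k K, (0 : ℤ) ≤ ((i + j) • poleDivisor k t +
        principalDivisor k (-t ^ i + t ^ j)) Q := by
      intro Q
      have hone : (1 : ℤᵐ⁰) ≤ WithZero.exp (poleDivisor k t Q) := by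
        rw [← WithZero.exp_zero, WithZero.exp_le_exp]; exact hpole Q
      have hb : ∀ m ≤ i + j, Q.val (t ^ m) ≤ WithZero.exp ((i + j) • poleDivisor k t Q) := by
        intro m hm
        rw [map_pow, WithZero.exp_nsmul]
        exact (pow_le_pow_left' (val_le_exp_poleDivisor Q t) m).trans (pow_le_pow_right' hone hm)
      have h1 : Q.val (-t ^ i + t ^ j) ≤ WithZero.exp ((i + j) • poleDivisor k t Q) :=
        (Q.val.map_add _ _).trans (max_le (by rw [Valuation.map_neg]; exact hb i (by omega))
          (hb j (by omega)))
      rw [val_eq_exp_neg Q hz, WithZero.exp_le_exp] at h1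
      rw [Finsupp.add_apply, Finsupp.smul_apply]
      linarith
    by_cases hQ : P = Q
    · subst hQ
      rw [Place.mem_ball, val_eq_exp_neg P hz, WithZero.exp_le_exp] at h
      have := nsmul_nonneg (hpole P) (i + j)
      rw [Finsupp.single_eq_same, Finsupp.add_apply, Finsupp.smul_apply]
      linarith
    · rw [Finsupp.single_apply, if_neg hQ]
      exact hle Q
  · refine ⟨1, 1, one_ne_zero, fun Q => ?_⟩
    have h1 : principalDivisor k (1 : K) = 0 := by ext; simp [principalDivisor_apply]
    rw [h1, one_nsmul, add_zero]
    by_cases hQ : P = Q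
    · subst hQ
      have := (not_le.mp hP).trans_le (val_le_exp_poleDivisor P t)
      rw [← WithZero.exp_zero, WithZero.exp_lt_exp] at this
      rw [Finsupp.single_eq_same]
      omega
    · rw [Finsupp.single_apply, if_neg hQ]
      exact hpole Q

theorem exists_le_nsmul_poleDivisor_add (t : K) (ht : Transcendental k t) (E : WeilDivisor k K) :
    ∃ (n : ℕ) (z : K), z ≠ 0 ∧ E ≤ n • poleDivisor k t + principalDivisor k z := by
  have hadd : ∀ E F : WeilDivisor k K,
      (∃ (n : ℕ) (z : K), z ≠ 0 ∧ E ≤ n • poleDivisor k t + principalDivisor k z) →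
      (∃ (n : ℕ) (z : K), z ≠ 0 ∧ F ≤ n • poleDivisor k t + principalDivisor k z) →
      ∃ (n : ℕ) (z : K), z ≠ 0 ∧ E + F ≤ n • poleDivisor k t + principalDivisor k z := by
    rintro E F ⟨n, z, hz, h⟩ ⟨m, w, hw, h'⟩
    refine ⟨n + m, z * w, mul_ne_zero hz hw, (add_le_add h h').trans_eq ?_⟩
    rw [principalDivisor_mul hz hw, add_nsmul]
    abel
  have hzero : ∀ F : WeilDivisor k K, F ≤ 0 →
      ∃ (n : ℕ) (z : K), z ≠ 0 ∧ F ≤ n • poleDivisor k t + principalDivisor k z := by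
    intro F hF
    have h1 : principalDivisor k (1 : K) = 0 := by ext; simp [principalDivisor_apply]
    exact ⟨0, 1, one_ne_zero, by simpa [h1] using hF⟩
  have hnat : ∀ (P : Place k K) (m : ℕ), ∃ (n : ℕ) (z : K), z ≠ 0 ∧
      Finsupp.single P (m : ℤ) ≤ n • poleDivisor k t + principalDivisor k z := by
    intro P m
    induction m with
    | zero => exact hzero _ (by simp)
    | succ m ih =>
      rw [Nat.cast_succ, Finsupp.single_add]
      exact hadd _ _ ih (exists_single_le t ht P)
  induction E using Finsupp.induction with
  | zero => exact hzero _ le_rfl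
  | single_add P m E _ _ ih =>
    refine hadd _ _ ?_ ih
    obtain ⟨n, z, hz, h⟩ := hnat P m.toNat
    exact ⟨n, z, hz, (Finsupp.single_le_single.mpr (Int.self_le_toNat m)).trans h⟩

variable (k K) in
/-- Riemann's inequality. -/
theorem exists_divisorNorm_le : ∃ B : ℚ, ∀ E : WeilDivisor k K,
    divisorNorm E ≤ B * Nat.card (riemannRochSpace k K E) := by
  obtain ⟨t, ht⟩ := IsFunctionFieldOfConst.exists_transcendental (k := k) (K := K)
  obtain ⟨C, hC, h⟩ := exists_pow_le_card_riemannRochSpace ht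
  -- E lies below F = C + n(t)_∞ + (z), and N/|L| can only grow from E to F. There N(F) = N(C) a^n
  -- while |L(F)| ≥ a^(n+1).
  refine ⟨divisorNorm C, fun E => ?_⟩
  obtain ⟨n, z, hz, hE⟩ := exists_le_nsmul_poleDivisor_add t ht E
  have hle : E ≤ (C + n • poleDivisor k t) + principalDivisor k z := by
    rw [add_assoc]
    exact hE.trans (le_add_of_nonneg_left hC)
  have hkey := card_mul_relIndex_mul_divisorNorm hle
  have hidx : (1 : ℚ) ≤ (adelicSpace E ⊔ (diagonalHom k K).range).relIndex
      (adelicSpace ((C + n • poleDivisor k t) + principalDivisor k z) ⊔ (diagonalHom k K).range) := by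
    exact_mod_cast Nat.one_le_iff_ne_zero.mpr (relIndex_sup_range_ne_zero hle)
  rw [card_riemannRochSpace_add_principalDivisor _ hz, divisorNorm_add, divisorNorm_add,
    divisorNorm_principalDivisor, divisorNorm_nsmul, divisorNorm_poleDivisor ht, mul_one] at hkey
  set a : ℚ := (Nat.card k : ℚ) ^ Module.finrank (IntermediateField.adjoin k {t}) K with ha
  have hcard : a ^ (n + 1) ≤ (Nat.card (riemannRochSpace k K (C + n • poleDivisor k t)) : ℚ) := by
    rw [ha, ← pow_mul]
    exact_mod_cast h n
  have ha1 : 1 ≤ a := one_le_pow₀ (by exact_mod_cast Nat.card_pos (α := k))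
  have hpow : a ^ n ≤ a ^ (n + 1) := pow_le_pow_right₀ ha1 (Nat.le_succ n)
  have hN := divisorNorm_pos E
  have h1 : a ^ n * divisorNorm E ≤ (divisorNorm C * Nat.card (riemannRochSpace k K E)) * a ^ n := by
    calc a ^ n * divisorNorm E ≤
        (Nat.card (riemannRochSpace k K (C + n • poleDivisor k t)) : ℚ) * 1 * divisorNorm E := by
          rw [mul_one]
          gcongr
          exact hpow.trans hcard
      _ ≤ _ := by gcongr
      _ = _ := hkey.trans (by ring)
  rw [mul_comm] at h1
  exact le_of_mul_le_mul_right h1 (by positivity)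

variable (k K) in
theorem range_diagonalHom_le : (diagonalHom k K).range ≤ (repartitions k K).toAddSubgroup := by
  rintro _ ⟨x, rfl⟩
  exact eventually_val_le_one x

/-- The number of elements of the quotient of the repartitions by `A(D) + K`. -/
noncomputable def specialityIndex (D : WeilDivisor k K) : ℕ :=
  (adelicSpace D ⊔ (diagonalHom k K).range).relIndex (repartitions k K).toAddSubgroup

theorem sup_range_le (D : WeilDivisor k K) :
    adelicSpace D ⊔ (diagonalHom k K).range ≤ (repartitions k K).toAddSubgroup :=
  sup_le (adelicSpace_le_repartitions D) (range_diagonalHom_le k K)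

theorem relIndex_mul_specialityIndex {D E : WeilDivisor k K} (h : D ≤ E) :
    (adelicSpace D ⊔ (diagonalHom k K).range).relIndex (adelicSpace E ⊔ (diagonalHom k K).range) *
      specialityIndex E = specialityIndex D :=
  AddSubgroup.relIndex_mul_relIndex _ _ _ (sup_range_mono h) (sup_range_le E)

variable (k K) in
-- For E ≥ 0 the index of A(0) + K in A(E) + K is q N(E)/|L(E)|, bounded by Riemann's inequality. An
-- E maximizing it cannot be improved by adding any A(D), and every repartition lies in some A(D).
theorem exists_sup_range_eq : ∃ E : WeilDivisor k K,
    0 ≤ E ∧ adelicSpace E ⊔ (diagonalHom k K).range = (repartitions k K).toAddSubgroup := by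
  obtain ⟨B, hB⟩ := exists_divisorNorm_le k K
  let f : WeilDivisor k K → ℕ := fun E => (adelicSpace 0 ⊔ (diagonalHom k K).range).relIndex
    (adelicSpace E ⊔ (diagonalHom k K).range)
  have hbdd : BddAbove (f '' Set.Ici 0) := by
    refine ⟨⌈Nat.card k * B⌉₊, ?_⟩
    rintro _ ⟨E, hE, rfl⟩
    have h1 := card_mul_relIndex_mul_divisorNorm hE
    rw [divisorNorm_zero, mul_one, card_riemannRochSpace_zero] at h1
    have h2 : (0 : ℚ) < Nat.card (riemannRochSpace k K E) := by exact_mod_cast Nat.card_pos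
    have h3 : (f E : ℚ) ≤ Nat.card k * B := by
      refine le_of_mul_le_mul_left ?_ h2
      rw [h1, mul_comm, mul_comm (Nat.card k : ℚ), ← mul_assoc]
      gcongr
      rw [mul_comm]
      exact hB E
    exact_mod_cast h3.trans (Nat.le_ceil _)
  obtain ⟨E, hE, hfE⟩ := Nat.sSup_mem (s := f '' Set.Ici 0) ⟨f 0, 0, Set.self_mem_Ici, rfl⟩ hbdd
  refine ⟨E, hE, le_antisymm (sup_range_le E) fun a ha => ?_⟩
  obtain ⟨D, hD⟩ := exists_mem_adelicSpace ha
  have h1 : f E * (adelicSpace E ⊔ (diagonalHom k K).range).relIndex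
      (adelicSpace (E ⊔ D) ⊔ (diagonalHom k K).range) = f (E ⊔ D) :=
    AddSubgroup.relIndex_mul_relIndex _ _ _ (sup_range_mono hE) (sup_range_mono le_sup_left)
  have h2 : f (E ⊔ D) ≤ f E := by
    rw [hfE]
    exact le_csSup hbdd ⟨E ⊔ D, le_trans (Set.mem_Ici.mp hE) le_sup_left, rfl⟩
  have h3 : f E ≠ 0 := relIndex_sup_range_ne_zero hE
  have h4 := relIndex_sup_range_ne_zero (le_sup_left : E ≤ E ⊔ D)
  have h5 : (adelicSpace E ⊔ (diagonalHom k K).range).relIndex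
      (adelicSpace (E ⊔ D) ⊔ (diagonalHom k K).range) ≤ 1 := by
    refine Nat.le_of_mul_le_mul_left ?_ (Nat.pos_of_ne_zero h3)
    rw [h1, mul_one]
    exact h2
  refine AddSubgroup.relIndex_eq_one.mp (le_antisymm h5 (Nat.one_le_iff_ne_zero.mpr h4)) (AddSubgroup.mem_sup_left (T := _) ?_)
  exact adelicSpace_le_iff.mpr le_sup_right hD

theorem specialityIndex_ne_zero (D : WeilDivisor k K) : specialityIndex D ≠ 0 := by
  obtain ⟨E, hE, h⟩ := exists_sup_range_eq k K
  have h1 : specialityIndex (D ⊓ 0) ≠ 0 := by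
    rw [specialityIndex, ← h]
    exact relIndex_sup_range_ne_zero (inf_le_right.trans hE)
  intro h0
  rw [← relIndex_mul_specialityIndex (inf_le_left : D ⊓ 0 ≤ D), h0, mul_zero] at h1
  exact h1 rfl

/-- The Riemann–Roch theorem, in multiplicative form and before duality. -/
theorem specialityIndex_mul_divisorNorm (D : WeilDivisor k K) :
    (specialityIndex D : ℚ) * divisorNorm D * Nat.card k =
      specialityIndex (0 : WeilDivisor k K) * Nat.card (riemannRochSpace k K D) := by
  -- The ratio i(D) N(D)/|L(D)| agrees on comparable divisors; D and 0 are compared through D ⊓ 0.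
  have key : ∀ {D E : WeilDivisor k K}, D ≤ E →
      (specialityIndex D : ℚ) * divisorNorm D * Nat.card (riemannRochSpace k K E) =
        specialityIndex E * divisorNorm E * Nat.card (riemannRochSpace k K D) := by
    intro D E h
    have h1 := card_mul_relIndex_mul_divisorNorm h
    rw [← relIndex_mul_specialityIndex h]
    push_cast
    linear_combination (specialityIndex E : ℚ) * h1
  have h1 := key (inf_le_left : D ⊓ 0 ≤ D)
  have h2 := key (inf_le_right : D ⊓ 0 ≤ 0)
  rw [divisorNorm_zero, mul_one, card_riemannRochSpace_zero] at h2
  have h3 : (Nat.card (riemannRochSpace k K (D ⊓ 0)) : ℚ) ≠ 0 := by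
    exact_mod_cast Nat.card_pos.ne'
  refine mul_right_cancel₀ h3 ?_
  linear_combination (Nat.card (riemannRochSpace k K D) : ℚ) * h2 - (Nat.card k : ℚ) * h1

end Riemann

/-! ### Weil differentials, duality and the genus -/

section Differentials

variable {k K : Type*} [Field k] [Field K] [Algebra k K]

/-- The subspace `A(D) + K` of the repartitions. -/
def vanishingSpace (D : WeilDivisor k K) : Submodule k (repartitions k K) where
  toAddSubmonoid := ((adelicSpace D ⊔ (diagonalHom k K).range).addSubgroupOf
    (repartitions k K).toAddSubgroup).toAddSubmonoid
  smul_mem' c a ha := by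
    obtain ⟨b, hb, _, ⟨x, rfl⟩, h⟩ := AddSubgroup.mem_sup.mp ha
    refine AddSubgroup.mem_sup.mpr ⟨c • b, mem_adelicSpace.mpr fun P => ?_, _, ⟨c • x, rfl⟩, ?_⟩
    · exact (P.val_smul_le c _).trans (mem_adelicSpace.mp hb P)
    · change _ = c • a.1
      change b + _ = a.1 at h
      rw [← h, smul_add]
      rfl

theorem mem_vanishingSpace {D : WeilDivisor k K} {a : repartitions k K} :
    a ∈ vanishingSpace D ↔ a.1 ∈ adelicSpace D ⊔ (diagonalHom k K).range := Iff.rfl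

theorem vanishesOn_iff {ω : Module.Dual k (repartitions k K)} {D : WeilDivisor k K} :
    VanishesOn k K ω D ↔ ω ∈ (vanishingSpace D).dualAnnihilator := by
  rw [Submodule.mem_dualAnnihilator]
  constructor
  · rintro ⟨h1, h2⟩ a ha
    rw [mem_vanishingSpace, AddSubgroup.mem_sup] at ha
    obtain ⟨b, hb, _, ⟨x, rfl⟩, h⟩ := ha
    have hb' := adelicSpace_le_repartitions D hb
    have hx' : diagonalHom k K x ∈ repartitions k K := by
      rw [← add_sub_cancel_left b (diagonalHom k K x), h]
      exact (repartitions k K).sub_mem a.2 hb'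
    have : a = ⟨b, hb'⟩ + ⟨_, hx'⟩ := Subtype.ext h.symm
    rw [this, map_add, h1 ⟨b, hb'⟩ (mem_adelicSpace.mp hb), h2 ⟨_, hx'⟩ ⟨x, fun P => rfl⟩, add_zero]
  · intro h
    refine ⟨fun a ha => h a (mem_vanishingSpace.mpr (AddSubgroup.mem_sup_left
      (mem_adelicSpace.mpr ha))), ?_⟩
    rintro a ⟨x, hx⟩
    exact h a (mem_vanishingSpace.mpr (AddSubgroup.mem_sup_right ⟨x, funext fun P => (hx P).symm⟩))

theorem VanishesOn.mono {ω : Module.Dual k (repartitions k K)} {D E : WeilDivisor k K} (h : D ≤ E)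
    (hω : VanishesOn k K ω E) : VanishesOn k K ω D :=
  ⟨fun a ha => hω.1 a fun P => (ha P).trans (WithZero.exp_le_exp.mpr (h P)), hω.2⟩

theorem VanishesOn.sup {ω : Module.Dual k (repartitions k K)} {D E : WeilDivisor k K}
    (hD : VanishesOn k K ω D) (hE : VanishesOn k K ω E) : VanishesOn k K ω (D ⊔ E) := by
  classical
  refine ⟨fun a ha => ?_, hD.2⟩
  -- A(D ⊔ E) = A(D) + A(E): the family is split according to which divisor is larger at each place.
  let b : Place k K → K := fun P => if E P ≤ D P then a.1 P else 0
  have hb : b ∈ adelicSpace D := mem_adelicSpace.mpr fun P => by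
    by_cases h : E P ≤ D P
    · have := ha P
      rw [Finsupp.sup_apply, sup_eq_left.mpr h] at this
      simpa [b, h] using this
    · simp [b, h]
  have hc : a.1 - b ∈ adelicSpace E := mem_adelicSpace.mpr fun P => by
    by_cases h : E P ≤ D P
    · simp [b, h]
    · have := ha P
      rw [Finsupp.sup_apply, sup_eq_right.mpr (not_le.mp h).le] at this
      simpa [b, h] using this
  have e : a = ⟨b, adelicSpace_le_repartitions D hb⟩ + ⟨_, adelicSpace_le_repartitions E hc⟩ :=
    Subtype.ext (add_sub_cancel _ _).symm
  rw [e, map_add, hD.1 _ (mem_adelicSpace.mp hb), hE.1 _ (mem_adelicSpace.mp hc), add_zero]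

variable [Finite k] [IsFunctionFieldOfConst k K]

/-- The annihilator is the dual of the finite quotient by A(D) + K, and a finite space has as many
elements as its dual. -/
theorem card_dualAnnihilator_vanishingSpace (D : WeilDivisor k K) :
    Nat.card (vanishingSpace D).dualAnnihilator = specialityIndex D := by
  have hidx : Nat.card (repartitions k K ⧸ vanishingSpace D) = specialityIndex D := rfl
  have : Finite (repartitions k K ⧸ vanishingSpace D) :=
    Nat.finite_of_card_ne_zero (hidx ▸ specialityIndex_ne_zero D)
  have : Module.Finite k (repartitions k K ⧸ vanishingSpace D) := Module.Finite.of_finite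
  rw [← Nat.card_congr (vanishingSpace D).dualQuotEquivDualAnnihilator.toEquiv, ← hidx,
    Module.natCard_eq_pow_finrank (K := k), Subspace.dual_finrank_eq,
    ← Module.natCard_eq_pow_finrank (K := k)]

instance (D : WeilDivisor k K) : Finite (vanishingSpace D).dualAnnihilator :=
  Nat.finite_of_card_ne_zero
    (card_dualAnnihilator_vanishingSpace D ▸ specialityIndex_ne_zero D)

variable (k) in
/-- Multiplication of repartitions by an element of `K`. -/
def mulRepartition (x : K) : repartitions k K →ₗ[k] repartitions k K where
  toFun a := ⟨fun P => x * a.1 P, by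
    obtain ⟨D, hD⟩ := exists_mem_adelicSpace a.2
    refine adelicSpace_le_repartitions (poleDivisor k x + D) (mem_adelicSpace.mpr fun P => ?_)
    rw [map_mul, Finsupp.add_apply, WithZero.exp_add]
    exact mul_le_mul' (val_le_exp_poleDivisor P x) (mem_adelicSpace.mp hD P)⟩
  map_add' a b := Subtype.ext (funext fun P => mul_add _ _ _)
  map_smul' c a := Subtype.ext (funext fun P => mul_smul_comm c x (a.1 P))

theorem mulRepartition_apply (x : K) (a : repartitions k K) (P : Place k K) :
    (mulRepartition k x a).1 P = x * a.1 P := rfl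

theorem mulRepartition_mul (x y : K) :
    mulRepartition k (x * y) = mulRepartition k x ∘ₗ mulRepartition k y :=
  LinearMap.ext fun _ => Subtype.ext (funext fun _ => mul_assoc _ _ _)

theorem mulRepartition_add (x y : K) :
    mulRepartition k (x + y) = mulRepartition k x + mulRepartition k y :=
  LinearMap.ext fun _ => Subtype.ext (funext fun _ => add_mul _ _ _)

theorem mulRepartition_neg (x : K) : mulRepartition k (-x) = -mulRepartition k x :=
  LinearMap.ext fun _ => Subtype.ext (funext fun _ => neg_mul _ _)

theorem mulRepartition_one : mulRepartition k (1 : K) = LinearMap.id :=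
  LinearMap.ext fun _ => Subtype.ext (funext fun _ => one_mul _)

theorem mulRepartition_zero : mulRepartition k (0 : K) = 0 :=
  LinearMap.ext fun _ => Subtype.ext (funext fun _ => zero_mul _)

theorem comp_mulRepartition_eq_zero {ω : Module.Dual k (repartitions k K)} (hω : ω ≠ 0) {x : K}
    (h : ω ∘ₗ mulRepartition k x = 0) : x = 0 := by
  by_contra hx
  refine hω ?_
  have : ω ∘ₗ mulRepartition k x ∘ₗ mulRepartition k x⁻¹ = 0 := by
    rw [← LinearMap.comp_assoc, h, LinearMap.zero_comp]
  rwa [← mulRepartition_mul, mul_inv_cancel₀ hx, mulRepartition_one, LinearMap.comp_id] at this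

theorem comp_mulRepartition_injective {ω : Module.Dual k (repartitions k K)} (hω : ω ≠ 0) {x y : K}
    (h : ω ∘ₗ mulRepartition k x = ω ∘ₗ mulRepartition k y) : x = y := by
  refine sub_eq_zero.mp (comp_mulRepartition_eq_zero hω ?_)
  rw [sub_eq_add_neg, mulRepartition_add, mulRepartition_neg, LinearMap.comp_add, LinearMap.comp_neg,
    h, add_neg_cancel]

theorem VanishesOn.comp_mulRepartition {ω : Module.Dual k (repartitions k K)}
    {D E F : WeilDivisor k K} (hω : VanishesOn k K ω E) {x : K} (hx : x ∈ riemannRochSpace k K D)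
    (h : D + F ≤ E) : VanishesOn k K (ω ∘ₗ mulRepartition k x) F := by
  constructor
  · intro a ha
    refine hω.1 _ fun P => ?_
    rw [mulRepartition_apply, map_mul]
    refine (mul_le_mul' (hx P) (ha P)).trans ?_
    rw [← WithZero.exp_add, WithZero.exp_le_exp]
    exact h P
  · rintro a ⟨y, hy⟩
    exact hω.2 _ ⟨x * y, fun P => by rw [mulRepartition_apply, hy P]⟩

variable (k K) in
theorem nonempty_place : Nonempty (Place k K) := by
  obtain ⟨t, ht⟩ := IsFunctionFieldOfConst.exists_transcendental (k := k) (K := K)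
  obtain ⟨P, -⟩ := exists_place_val_lt_one ht
  exact ⟨P⟩

variable (k K) in
theorem exists_divisorNorm_gt (B : ℚ) : ∃ D : WeilDivisor k K, 0 ≤ D ∧ B < divisorNorm D := by
  obtain ⟨P⟩ := nonempty_place k K
  have hc : (1 : ℚ) < P.resCard := by exact_mod_cast P.two_le_resCard
  obtain ⟨n, hn⟩ := pow_unbounded_of_one_lt B hc
  refine ⟨Finsupp.single P (n : ℤ), Finsupp.single_nonneg.mpr (by simp), ?_⟩
  rwa [divisorNorm_single, zpow_natCast]

theorem divisorNorm_mul_card_le (D : WeilDivisor k K) :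
    divisorNorm D * Nat.card k ≤
      specialityIndex (0 : WeilDivisor k K) * Nat.card (riemannRochSpace k K D) := by
  rw [← specialityIndex_mul_divisorNorm, mul_assoc]
  refine le_mul_of_one_le_left (mul_nonneg (divisorNorm_pos D).le (Nat.cast_nonneg _)) ?_
  exact_mod_cast Nat.one_le_iff_ne_zero.mpr (specialityIndex_ne_zero D)

variable (k K) in
-- Riemann–Roch for -D gives i(-D) ≥ N(D)/q, which exceeds 1 once N(D) > q.
theorem exists_isWeilDifferential_ne_zero :
    ∃ ω : Module.Dual k (repartitions k K), IsWeilDifferential k K ω ∧ ω ≠ 0 := by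
  obtain ⟨D, hD, h⟩ := exists_divisorNorm_gt k K (Nat.card k)
  have h1 : 1 < specialityIndex (-D) := by
    have h2 := specialityIndex_mul_divisorNorm (-D)
    rw [divisorNorm_neg] at h2
    have h3 : (1 : ℚ) ≤ specialityIndex (0 : WeilDivisor k K) := by
      exact_mod_cast Nat.one_le_iff_ne_zero.mpr (specialityIndex_ne_zero 0)
    have h4 : (1 : ℚ) ≤ Nat.card (riemannRochSpace k K (-D)) := by
      exact_mod_cast Nat.card_pos
    have h5 : (1 : ℚ) ≤ specialityIndex (-D) * (divisorNorm D)⁻¹ * Nat.card k := by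
      rw [h2]; nlinarith
    have hN := divisorNorm_pos D
    have h6 : divisorNorm D ≤ specialityIndex (-D) * Nat.card k := by
      have := mul_le_mul_of_nonneg_left h5 hN.le
      rw [mul_one] at this
      refine this.trans_eq ?_
      field_simp
    by_contra! hle
    have h7 : (specialityIndex (-D) : ℚ) ≤ 1 := by exact_mod_cast hle
    have h8 : (specialityIndex (-D) : ℚ) * Nat.card k ≤ 1 * Nat.card k := by gcongr
    linarith
  rw [← card_dualAnnihilator_vanishingSpace, Finite.one_lt_card_iff_nontrivial] at h1
  obtain ⟨ω, hω⟩ := exists_ne (0 : (vanishingSpace (-D)).dualAnnihilator)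
  exact ⟨ω, ⟨-D, vanishesOn_iff.mpr ω.2⟩, fun h => hω (Subtype.ext h)⟩

/-- The Weil differentials form a one-dimensional vector space over `K`. -/
theorem exists_eq_comp_mulRepartition {ω η : Module.Dual k (repartitions k K)} (hω : ω ≠ 0)
    (hω' : IsWeilDifferential k K ω) (hη' : IsWeilDifferential k K η) :
    ∃ x : K, η = ω ∘ₗ mulRepartition k x := by
  by_contra! hne
  obtain ⟨D₁, hD₁⟩ := hω'
  obtain ⟨D₂, hD₂⟩ := hη'
  obtain ⟨D₀, h1, h2⟩ : ∃ D₀, VanishesOn k K ω D₀ ∧ VanishesOn k K η D₀ :=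
    ⟨D₁ ⊓ D₂, hD₁.mono inf_le_left, hD₂.mono inf_le_right⟩
  set c : ℚ := (specialityIndex (0 : WeilDivisor k K) : ℚ) with hc
  have hc0 : 0 < c := Nat.cast_pos.mpr (Nat.pos_of_ne_zero (specialityIndex_ne_zero 0))
  set q : ℚ := (Nat.card k : ℚ) with hq
  have hq0 : 0 < q := Nat.cast_pos.mpr Nat.card_pos
  have hN₀ := divisorNorm_pos D₀
  -- With h = |L(D₀ + D)|, the estimates N(D₀)N(D)q ≤ ch and h² ≤ i(-D) ≤ cN(D) force N(D) ≤
  -- c³/(N(D₀)q)²; D is chosen beyond this bound.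
  obtain ⟨D, hD, hbig⟩ := exists_divisorNorm_gt k K (c ^ 3 / (divisorNorm D₀ * q) ^ 2)
  have hN := divisorNorm_pos D
  -- If η is no multiple of ω, then (x, y) ↦ xω + yη is injective on L(D₀ + D)², with values
  -- vanishing on A(-D) + K.
  have hinj : Nat.card (riemannRochSpace k K (D₀ + D)) * Nat.card (riemannRochSpace k K (D₀ + D)) ≤
      specialityIndex (-D) := by
    rw [← Nat.card_prod, ← card_dualAnnihilator_vanishingSpace]
    refine Nat.card_le_card_of_injective (fun p => ⟨ω ∘ₗ mulRepartition k p.1.1 +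
      η ∘ₗ mulRepartition k p.2.1, Submodule.add_mem _
        (vanishesOn_iff.mp (h1.comp_mulRepartition p.1.2 (by simp)))
        (vanishesOn_iff.mp (h2.comp_mulRepartition p.2.2 (by simp)))⟩) ?_
    have hzero : ∀ x y : K, ω ∘ₗ mulRepartition k x + η ∘ₗ mulRepartition k y = 0 →
        x = 0 ∧ y = 0 := by
      intro x y h
      have hy : y = 0 := by
        by_contra hy
        refine hne (-x * y⁻¹) ?_
        have h3 : η ∘ₗ mulRepartition k y = ω ∘ₗ mulRepartition k (-x) := by
          rw [mulRepartition_neg, LinearMap.comp_neg]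
          exact eq_neg_of_add_eq_zero_right h
        rw [mulRepartition_mul, ← LinearMap.comp_assoc, ← h3, LinearMap.comp_assoc,
          ← mulRepartition_mul, mul_inv_cancel₀ hy, mulRepartition_one, LinearMap.comp_id]
      rw [hy, mulRepartition_zero, LinearMap.comp_zero, add_zero] at h
      exact ⟨comp_mulRepartition_eq_zero hω h, hy⟩
    rintro ⟨x, y⟩ ⟨x', y'⟩ h
    have h' := congrArg Subtype.val h
    obtain ⟨h3, h4⟩ := hzero (x.1 - x'.1) (y.1 - y'.1) (by
      simp only [sub_eq_add_neg, mulRepartition_add, mulRepartition_neg, LinearMap.comp_add,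
        LinearMap.comp_neg]
      have h'' : ω ∘ₗ mulRepartition k x.1 + η ∘ₗ mulRepartition k y.1 =
        ω ∘ₗ mulRepartition k x'.1 + η ∘ₗ mulRepartition k y'.1 := h'
      rw [← sub_eq_zero] at h''
      rw [← h'']
      abel)
    exact Prod.ext (Subtype.ext (sub_eq_zero.mp h3)) (Subtype.ext (sub_eq_zero.mp h4))
  have hup : (specialityIndex (-D) : ℚ) ≤ c * divisorNorm D := by
    have h3 := specialityIndex_mul_divisorNorm (-D)
    have h4 : Nat.card (riemannRochSpace k K (-D)) ≤ Nat.card k := by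
      rw [← card_riemannRochSpace_zero k K, ← card_riemannRochSpace_mul (neg_nonpos.mpr hD)]
      refine Nat.le_mul_of_pos_right _ (Nat.pos_of_ne_zero fun h0 => ?_)
      have h5 := card_riemannRochSpace_mul (k := k) (K := K) (neg_nonpos.mpr hD)
      rw [h0, mul_zero] at h5
      exact Nat.card_pos.ne h5
    have h5 : (Nat.card (riemannRochSpace k K (-D)) : ℚ) ≤ q := by
      rw [hq]
      exact_mod_cast h4
    rw [divisorNorm_neg] at h3
    have h6 : (specialityIndex (-D) : ℚ) * q = c * divisorNorm D *
        Nat.card (riemannRochSpace k K (-D)) := by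
      calc (specialityIndex (-D) : ℚ) * q
          = (specialityIndex (-D) * (divisorNorm D)⁻¹ * q) * divisorNorm D := by field_simp
        _ = _ := by rw [h3]; ring
    refine le_of_mul_le_mul_right ?_ hq0
    rw [h6]
    gcongr
  have hlow := divisorNorm_mul_card_le (D₀ + D)
  rw [divisorNorm_add] at hlow
  have hinj' : (Nat.card (riemannRochSpace k K (D₀ + D)) : ℚ) *
      Nat.card (riemannRochSpace k K (D₀ + D)) ≤ specialityIndex (-D) := by exact_mod_cast hinj
  set h : ℚ := (Nat.card (riemannRochSpace k K (D₀ + D)) : ℚ)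
  have hfin : (divisorNorm D₀ * divisorNorm D * q) ^ 2 ≤ c ^ 3 * divisorNorm D := by
    calc (divisorNorm D₀ * divisorNorm D * q) ^ 2 ≤ (c * h) ^ 2 := by gcongr
      _ = c ^ 2 * (h * h) := by ring
      _ ≤ c ^ 2 * (c * divisorNorm D) :=
        mul_le_mul_of_nonneg_left (hinj'.trans hup) (by positivity)
      _ = _ := by ring
  rw [div_lt_iff₀ (by positivity)] at hbig
  have : c ^ 3 * divisorNorm D < (divisorNorm D * (divisorNorm D₀ * q) ^ 2) * divisorNorm D := by
    gcongr
  nlinarith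

theorem card_riemannRochSpace_le_of_vanishesOn {ω : Module.Dual k (repartitions k K)} (hω : ω ≠ 0)
    {D : WeilDivisor k K} (hD : VanishesOn k K ω D) :
    Nat.card (riemannRochSpace k K D) ≤ specialityIndex (0 : WeilDivisor k K) := by
  rw [← card_dualAnnihilator_vanishingSpace]
  exact Nat.card_le_card_of_injective (fun x => ⟨ω ∘ₗ mulRepartition k x.1,
    vanishesOn_iff.mp (hD.comp_mulRepartition x.2 (by simp))⟩)
    fun x y h => Subtype.ext (comp_mulRepartition_injective hω (congrArg Subtype.val h))

/-- If ω vanishes on A(E) + K, then x ↦ xω embeds L(E) in the differentials counted by i(0), so N(E)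
≤ i(0)|L(E)| ≤ i(0)². Hence some E ≥ D₁ has maximal index over D₁, and closure under ⊔ makes it the
greatest. -/
theorem exists_isGreatest_vanishesOn {ω : Module.Dual k (repartitions k K)} (hω : ω ≠ 0)
    (hω' : IsWeilDifferential k K ω) :
    ∃ W, IsGreatest {D : WeilDivisor k K | VanishesOn k K ω D} W := by
  obtain ⟨D₁, hD₁⟩ := hω'
  let f : WeilDivisor k K → ℕ := fun E => (adelicSpace D₁).relIndex (adelicSpace E)
  let S : Set (WeilDivisor k K) := {E | D₁ ≤ E ∧ VanishesOn k K ω E}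
  set c := specialityIndex (0 : WeilDivisor k K)
  have hN := divisorNorm_pos D₁
  have hbdd : BddAbove (f '' S) := by
    refine ⟨⌈(c * c : ℚ) / divisorNorm D₁⌉₊, ?_⟩
    rintro _ ⟨E, ⟨hE, hE'⟩, rfl⟩
    have h1 := relIndex_adelicSpace hE
    have h2 := divisorNorm_mul_card_le E
    have h3 : (Nat.card (riemannRochSpace k K E) : ℚ) ≤ c := by
      exact_mod_cast card_riemannRochSpace_le_of_vanishesOn hω hE'
    have h4 : (1 : ℚ) ≤ Nat.card k := by exact_mod_cast Nat.card_pos (α := k)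
    have h5 : divisorNorm E ≤ c * c := by
      calc divisorNorm E ≤ divisorNorm E * Nat.card k :=
            le_mul_of_one_le_right (divisorNorm_pos E).le h4
        _ ≤ c * Nat.card (riemannRochSpace k K E) := h2
        _ ≤ c * c := by gcongr
    have h6 : (f E : ℚ) ≤ c * c / divisorNorm D₁ := by
      rw [le_div_iff₀ hN, h1]
      exact h5
    exact_mod_cast h6.trans (Nat.le_ceil _)
  obtain ⟨W, ⟨hW, hW'⟩, hfW⟩ := Nat.sSup_mem (s := f '' S) ⟨f D₁, D₁, ⟨le_rfl, hD₁⟩, rfl⟩ hbdd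
  refine ⟨W, hW', fun D hD => ?_⟩
  have h1 : f W * (adelicSpace W).relIndex (adelicSpace (W ⊔ D)) = f (W ⊔ D) :=
    AddSubgroup.relIndex_mul_relIndex _ _ _ (adelicSpace_le_iff.mpr hW)
      (adelicSpace_le_iff.mpr le_sup_left)
  have h2 : f (W ⊔ D) ≤ f W := by
    rw [hfW]
    exact le_csSup hbdd ⟨W ⊔ D, ⟨hW.trans le_sup_left, hW'.sup hD⟩, rfl⟩
  have h3 : f W ≠ 0 := relIndex_adelicSpace_ne_zero hW
  have h4 := relIndex_adelicSpace_ne_zero (le_sup_left : W ≤ W ⊔ D)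
  have h5 : (adelicSpace W).relIndex (adelicSpace (W ⊔ D)) ≤ 1 := by
    refine Nat.le_of_mul_le_mul_left ?_ (Nat.pos_of_ne_zero h3)
    rw [h1, mul_one]
    exact h2
  have h6 := AddSubgroup.relIndex_eq_one.mp (le_antisymm h5 (Nat.one_le_iff_ne_zero.mpr h4))
  exact le_sup_right.trans (adelicSpace_le_iff.mp h6)

/-- Duality: x ↦ xω is a bijection from L(W) onto the differentials vanishing on A(0) + K. -/
theorem IsCanonicalDivisor.card_riemannRochSpace {W : WeilDivisor k K}
    (hW : IsCanonicalDivisor k K W) :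
    Nat.card (riemannRochSpace k K W) = specialityIndex (0 : WeilDivisor k K) := by
  obtain ⟨ω, hω', hω, hWω, hmax⟩ := hW
  rw [← card_dualAnnihilator_vanishingSpace]
  refine Nat.card_congr (Equiv.ofBijective (fun x => ⟨ω ∘ₗ mulRepartition k x.1,
    vanishesOn_iff.mp (VanishesOn.comp_mulRepartition hWω x.2 (by simp))⟩)
    ⟨fun x y h => Subtype.ext (comp_mulRepartition_injective hω (congrArg Subtype.val h)), ?_⟩)
  rintro ⟨η, hη⟩
  rw [← vanishesOn_iff] at hη
  obtain ⟨x, rfl⟩ := exists_eq_comp_mulRepartition hω hω' ⟨0, hη⟩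
  refine ⟨⟨x, fun P => ?_⟩, rfl⟩
  by_cases hx : x = 0
  · simp [hx]
  rw [val_eq_exp_neg P hx, WithZero.exp_le_exp]
  -- If xω vanishes on A(0), then ω = x⁻¹(xω) vanishes on A(-(x)); maximality of W gives -(x) ≤ W,
  -- that is x ∈ L(W).
  have hle : -principalDivisor k x ≤ W := by
    refine hmax ?_
    have hxinv : x⁻¹ ∈ riemannRochSpace k K (principalDivisor k x) := fun P => by
      rw [val_eq_exp_neg P (inv_ne_zero hx), principalDivisor_inv, Finsupp.neg_apply, neg_neg]
    have h := hη.comp_mulRepartition hxinv (F := -principalDivisor k x) (by simp)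
    rwa [LinearMap.comp_assoc, ← mulRepartition_mul, mul_inv_cancel₀ hx, mulRepartition_one,
      LinearMap.comp_id] at h
  exact hle P

variable (k K) in
theorem exists_isGenus : ∃ g : ℕ, IsGenus k K g ∧
    specialityIndex (0 : WeilDivisor k K) = Nat.card k ^ g := by
  obtain ⟨ω, hω', hω⟩ := exists_isWeilDifferential_ne_zero k K
  obtain ⟨W, hW⟩ := exists_isGreatest_vanishesOn hω hω'
  have hcan : IsCanonicalDivisor k K W := ⟨ω, hω', hω, hW⟩
  have hcard : ∀ D : WeilDivisor k K, IsCanonicalDivisor k K D →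
      specialityIndex (0 : WeilDivisor k K) =
        Nat.card k ^ Module.finrank k (riemannRochSpace k K D) := fun D hD => by
    rw [← hD.card_riemannRochSpace, Module.natCard_eq_pow_finrank (K := k)]
  refine ⟨_, ⟨⟨W, hcan⟩, fun D hD => ⟨Module.Finite.of_finite, ?_⟩⟩, hcard W hcan⟩
  exact Nat.pow_right_injective (Finite.one_lt_card (α := k)) ((hcard D hD).symm.trans (hcard W hcan))

end Differentials

/-! ### Quotient measures and their total mass -/

section QuotientMeasure

variable {G : Type*} [AddCommGroup G] (Γ H : AddSubgroup G)

/-- A union of cosets of `H`, one in each coset of `H ⊔ Γ`. -/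
def cosetTransversal : Set G :=
  {x | x - (QuotientAddGroup.mk x : G ⧸ (H ⊔ Γ)).out ∈ H}

theorem mem_cosetTransversal {x : G} :
    x ∈ cosetTransversal Γ H ↔ x - (QuotientAddGroup.mk x : G ⧸ (H ⊔ Γ)).out ∈ H := Iff.rfl

theorem cosetTransversal_eq_iUnion :
    cosetTransversal Γ H = ⋃ c : G ⧸ (H ⊔ Γ), {x | -c.out + x ∈ H} := by
  ext x
  simp only [Set.mem_iUnion, mem_cosetTransversal, Set.mem_ofPred_eq, sub_eq_neg_add]
  constructor
  · exact fun h => ⟨_, h⟩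
  · rintro ⟨c, hc⟩
    have : (QuotientAddGroup.mk x : G ⧸ (H ⊔ Γ)) = c := by
      rw [← QuotientAddGroup.out_eq' c, eq_comm, QuotientAddGroup.eq]
      exact AddSubgroup.mem_sup_left hc
    rwa [this]

/-- The chosen representative is constant along x + Γ. If x differs from it by h + γ₀, then x + γ
lies in the transversal exactly when γ₀ + γ ∈ H, so translation by γ₀ matches these γ with H ∩ Γ. -/
theorem tsum_indicator_cosetTransversal [Finite (H ⊓ Γ : AddSubgroup G)] (x : G) :
    ∑' γ : Γ, (cosetTransversal Γ H).indicator (fun _ => (1 : ℝ≥0∞)) (x + γ)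
      = Nat.card (H ⊓ Γ : AddSubgroup G) := by
  have hx : x - (QuotientAddGroup.mk x : G ⧸ (H ⊔ Γ)).out ∈ H ⊔ Γ := by
    rw [sub_eq_neg_add, ← QuotientAddGroup.eq, QuotientAddGroup.out_eq']
  obtain ⟨h, hh, γ₀, hγ₀, he⟩ := AddSubgroup.mem_sup.mp hx
  have hmem : ∀ γ : Γ, x + γ ∈ cosetTransversal Γ H ↔ γ₀ + (γ : G) ∈ H := by
    intro γ
    have h1 : (QuotientAddGroup.mk (x + γ) : G ⧸ (H ⊔ Γ)) = QuotientAddGroup.mk x := by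
      rw [eq_comm, QuotientAddGroup.eq, neg_add_cancel_left]
      exact AddSubgroup.mem_sup_right γ.2
    rw [mem_cosetTransversal, h1, add_sub_right_comm, ← he, add_assoc]
    exact H.add_mem_cancel_left hh
  let S : Set Γ := {γ | (γ : G) ∈ H}
  have h2 : ∀ γ : Γ, (cosetTransversal Γ H).indicator (fun _ => (1 : ℝ≥0∞)) (x + γ)
      = S.indicator (fun _ => 1) (Equiv.addLeft (⟨γ₀, hγ₀⟩ : Γ) γ) := by
    classical
    intro γ
    rw [Set.indicator_apply, Set.indicator_apply]
    exact if_congr (hmem γ) rfl rfl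
  simp_rw [h2]
  rw [Equiv.tsum_eq (Equiv.addLeft (⟨γ₀, hγ₀⟩ : Γ)) (S.indicator fun _ => (1 : ℝ≥0∞)),
    ← tsum_subtype S (fun _ => (1 : ℝ≥0∞)), ENNReal.tsum_set_one]
  let e : S ≃ (H ⊓ Γ : AddSubgroup G) :=
    { toFun := fun s => ⟨s.1.1, s.2, s.1.2⟩
      invFun := fun s => ⟨⟨s.1, s.2.2⟩, s.2.1⟩
      left_inv := fun _ => rfl
      right_inv := fun _ => rfl }
  have : Finite S := Finite.of_equiv _ e.symm
  rw [← Nat.card_congr e, Nat.card_coe_set_eq, ← Set.Finite.cast_ncard_eq (Set.toFinite S)]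
  rfl

theorem tsum_fiber_mk (f : G → ℝ≥0∞) (x : G) :
    ∑' y : {y : G // (QuotientAddGroup.mk y : G ⧸ Γ) = QuotientAddGroup.mk x}, f y.1
      = ∑' γ : Γ, f (x + γ) := by
  let e : Γ ≃ {y : G // (QuotientAddGroup.mk y : G ⧸ Γ) = QuotientAddGroup.mk x} :=
    { toFun := fun γ => ⟨x + γ, by rw [eq_comm, QuotientAddGroup.eq]; simp⟩
      invFun := fun y => ⟨-x + y.1, QuotientAddGroup.eq.mp y.2.symm⟩
      left_inv := fun γ => by simp
      right_inv := fun y => by simp }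
  exact (Equiv.tsum_eq e fun y => f y.1).symm

variable [MeasurableSpace G] [MeasurableAdd G]

theorem measurableSet_cosetTransversal [Finite (G ⧸ (H ⊔ Γ))] (hH : MeasurableSet (H : Set G)) :
    MeasurableSet (cosetTransversal Γ H) := by
  rw [cosetTransversal_eq_iUnion]
  exact MeasurableSet.iUnion fun c => measurable_const_add _ hH

theorem measure_cosetTransversal [Finite (G ⧸ (H ⊔ Γ))] (hH : MeasurableSet (H : Set G))
    (μ : Measure G) [μ.IsAddLeftInvariant] :
    μ (cosetTransversal Γ H) = Nat.card (G ⧸ (H ⊔ Γ)) * μ H := by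
  have := Fintype.ofFinite (G ⧸ (H ⊔ Γ))
  have hm : ∀ c : G ⧸ (H ⊔ Γ), MeasurableSet {x | -c.out + x ∈ H} := fun c =>
    measurable_const_add _ hH
  rw [cosetTransversal_eq_iUnion, measure_iUnion ?_ hm, tsum_fintype]
  · have : ∀ c : G ⧸ (H ⊔ Γ), μ {x | -c.out + x ∈ H} = μ H := fun c =>
      measure_preimage_add μ _ _
    simp [this]
  · intro c d hcd
    refine Set.disjoint_left.mpr fun x hx hx' => hcd ?_
    rw [← QuotientAddGroup.out_eq' c, ← QuotientAddGroup.out_eq' d, QuotientAddGroup.eq]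
    refine AddSubgroup.mem_sup_left ?_
    have := H.sub_mem hx hx'
    rwa [show -c.out + x - (-d.out + x) = -c.out + d.out by abel] at this

theorem IsQuotientMeasure.measure_univ [Finite (H ⊓ Γ : AddSubgroup G)] [Finite (G ⧸ (H ⊔ Γ))]
    (hH : MeasurableSet (H : Set G)) {μ : Measure G} [μ.IsAddLeftInvariant]
    {ν : Measure (G ⧸ Γ)} (hν : IsQuotientMeasure Γ μ ν) :
    Nat.card (H ⊓ Γ : AddSubgroup G) * ν Set.univ = Nat.card (G ⧸ (H ⊔ Γ)) * μ H := by
  have hU := measurableSet_cosetTransversal Γ H hH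
  have h := hν ((cosetTransversal Γ H).indicator fun _ => 1) (measurable_const.indicator hU)
  have hF : ∀ c : G ⧸ Γ, ∑' x : {x : G // (QuotientAddGroup.mk x : G ⧸ Γ) = c},
      (cosetTransversal Γ H).indicator (fun _ => (1 : ℝ≥0∞)) x.1
        = Nat.card (H ⊓ Γ : AddSubgroup G) := by
    intro c
    induction c using QuotientAddGroup.induction_on with
    | H x => rw [tsum_fiber_mk, tsum_indicator_cosetTransversal]
  rw [lintegral_indicator hU, setLIntegral_const, one_mul, measure_cosetTransversal Γ H hH] at h
  simp_rw [hF] at h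
  rw [lintegral_const] at h
  exact h.symm

/-- The pushforward of μ restricted to U counts each Γ-coset |H ∩ Γ| times, so dividing by this
number gives ν. -/
theorem exists_isQuotientMeasure [Countable Γ] [Finite (H ⊓ Γ : AddSubgroup G)]
    [Finite (G ⧸ (H ⊔ Γ))] (hH : MeasurableSet (H : Set G)) (μ : Measure G)
    [μ.IsAddLeftInvariant] : ∃ ν : Measure (G ⧸ Γ), IsQuotientMeasure Γ μ ν := by
  have hU := measurableSet_cosetTransversal Γ H hH
  set U := cosetTransversal Γ H with hUdef
  have hmk : Measurable (QuotientAddGroup.mk : G → G ⧸ Γ) := QuotientAddGroup.measurable_coe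
  set q : ℝ≥0∞ := (Nat.card (H ⊓ Γ : AddSubgroup G) : ℝ≥0∞) with hq
  have hq0 : q ≠ 0 := Nat.cast_ne_zero.mpr Nat.card_pos.ne'
  have hqt : q ≠ ∞ := ENNReal.natCast_ne_top _
  refine ⟨q⁻¹ • (μ.restrict U).map QuotientAddGroup.mk, fun f hf => ?_⟩
  have htrans : ∀ γ : G, Measurable fun x : G => x + γ := fun γ => measurable_add_const γ
  have hFm : Measurable fun c : G ⧸ Γ =>
      ∑' x : {x : G // (QuotientAddGroup.mk x : G ⧸ Γ) = c}, f x.1 := by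
    refine QuotientAddGroup.measurable_from_quotient.mpr ?_
    have : (fun c : G ⧸ Γ => ∑' x : {x : G // (QuotientAddGroup.mk x : G ⧸ Γ) = c}, f x.1) ∘
        QuotientAddGroup.mk = fun x => ∑' γ : Γ, f (x + γ) := funext fun x => tsum_fiber_mk Γ f x
    rw [this]
    exact Measurable.tsum fun γ => hf.comp (htrans γ)
  rw [lintegral_smul_measure, lintegral_map hFm hmk]
  simp_rw [tsum_fiber_mk]
  rw [lintegral_tsum (f := fun (γ : Γ) x => f (x + γ))
    fun γ => (hf.comp (htrans γ)).aemeasurable]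
  -- Invariance of μ moves the shift from f to U; summing over γ then produces the constant count
  -- `q`.
  have hterm : ∀ γ : Γ, ∫⁻ x in U, f (x + γ) ∂μ
      = ∫⁻ x, f x * U.indicator (fun _ => 1) (x + ((-γ : Γ) : G)) ∂μ := by
    intro γ
    rw [← lintegral_indicator hU, ← lintegral_add_left_eq_self (μ := μ)
      (fun x => f x * U.indicator (fun _ => 1) (x + ((-γ : Γ) : G))) (γ : G)]
    refine lintegral_congr fun x => ?_
    have h1 : (γ : G) + x + ((-γ : Γ) : G) = x := by
      rw [AddSubgroup.coe_neg]; abel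
    rw [h1, add_comm (γ : G) x]
    by_cases hx : x ∈ U <;> simp [hx]
  simp_rw [hterm]
  rw [← lintegral_tsum (f := fun (γ : Γ) x => f x * U.indicator (fun _ => 1) (x + ((-γ : Γ) : G)))
    fun γ => (hf.mul ((measurable_const.indicator hU).comp (htrans _))).aemeasurable]
  have hsum : ∀ x, ∑' γ : Γ, f x * U.indicator (fun _ => 1) (x + ((-γ : Γ) : G)) = f x * q := by
    intro x
    rw [ENNReal.tsum_mul_left, hq, ← tsum_indicator_cosetTransversal Γ H x]
    congr 1
    exact Equiv.tsum_eq (Equiv.neg Γ) fun γ : Γ => U.indicator (fun _ => (1 : ℝ≥0∞)) (x + γ)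
  simp_rw [hsum]
  rw [lintegral_mul_const _ hf, smul_eq_mul, mul_comm _ q, ← mul_assoc,
    ENNReal.inv_mul_cancel hq0 hqt, one_mul]

end QuotientMeasure

/-! ### Compactness of the local integers -/

section LocalFields

variable {k K : Type*} [Field k] [Field K] [Algebra k K]

namespace Place

/-- The valuation of the local field `K_P`. -/
noncomputable abbrev localVal (P : Place k K) : Valuation P.LocalField ℤᵐ⁰ :=
  Valued.v (R := P.LocalField) (Γ₀ := ℤᵐ⁰)

theorem localVal_toLocal (P : Place k K) (x : K) : P.localVal (P.toLocal x) = P.val x :=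
  Valued.valuedCompletion_apply (K := WithVal P.val) _

theorem mem_localIntegers (P : Place k K) {x : P.LocalField} :
    x ∈ P.localIntegers ↔ P.localVal x ≤ 1 := Iff.rfl

theorem isOpen_setOf_localVal_le (P : Place k K) (n : ℤ) :
    IsOpen {x : P.LocalField | P.localVal x ≤ WithZero.exp n} := by
  obtain ⟨y, hy0, hy⟩ := P.exists_val_eq n
  have h : P.localVal (P.toLocal y) ≠ 0 := by
    rw [localVal_toLocal, hy]; exact WithZero.exp_ne_zero
  have := Valued.isOpen_closedBall P.LocalField (r := P.localVal.restrict (P.toLocal y))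
    (by rwa [ne_eq, Valuation.restrict_eq_zero_iff])
  simpa only [Valuation.restrict_le_iff, localVal_toLocal, hy] using this

theorem exists_localVal_sub_le (P : Place k K) (x : P.LocalField) (n : ℤ) :
    ∃ y : K, P.localVal (x - P.toLocal y) ≤ WithZero.exp n := by
  have hopen : IsOpen ((fun z : P.LocalField => x - z) ⁻¹' {z | P.localVal z ≤ WithZero.exp n}) :=
    (P.isOpen_setOf_localVal_le n).preimage (by fun_prop)
  obtain ⟨w, hw⟩ := (UniformSpace.Completion.denseRange_coe (α := WithVal P.val)).exists_mem_open
    hopen ⟨x, by simp⟩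
  exact ⟨WithVal.equiv P.val w, hw⟩

theorem relIndex_ball_ne_zero [Finite k] [IsFunctionFieldOfConst k K] (P : Place k K) {m n : ℤ}
    (h : m ≤ n) : (P.ball m).relIndex (P.ball n) ≠ 0 := by
  obtain ⟨d, rfl⟩ := Int.le.dest h
  rw [relIndex_ball_add]
  exact pow_ne_zero _ P.resCard_ne_zero

theorem totallyBounded_localIntegers [Finite k] [IsFunctionFieldOfConst k K] (P : Place k K) :
    TotallyBounded (P.localIntegers : Set P.LocalField) := by
  rw [totallyBounded_iff_subset_finite_iUnion_nhds_zero]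
  intro U hU
  obtain ⟨γ, hγ⟩ := Valued.mem_nhds_zero.mp hU
  obtain ⟨r, hr⟩ : ∃ r, P.localVal.restrict r = γ.1 :=
    MonoidWithZeroHom.ValueGroup₀.restrict₀_surjective (.ofClass P.localVal) γ.1
  have hr0 : P.localVal r ≠ 0 := by
    rw [ne_eq, ← Valuation.restrict_eq_zero_iff, hr]; exact γ.ne_zero
  obtain ⟨n, hn0, hn⟩ : ∃ n : ℤ, n ≤ 0 ∧ WithZero.exp n < P.localVal r := by
    refine ⟨min 0 (WithZero.log (P.localVal r) - 1), min_le_left _ _, ?_⟩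
    conv_rhs => rw [← WithZero.exp_log hr0]
    rw [WithZero.exp_lt_exp]
    omega
  have hU' : ∀ x, P.localVal x ≤ WithZero.exp n → x ∈ U := fun x hx => hγ (by
    change P.localVal.restrict x < _
    rw [← hr, Valuation.restrict_lt_iff]
    exact hx.trans_lt hn)
  have hfin : Finite (P.ball 0 ⧸ (P.ball n).addSubgroupOf (P.ball 0)) :=
    Nat.finite_of_card_ne_zero (P.relIndex_ball_ne_zero hn0)
  -- K is dense in K_P and the ball of exponent n has finite index in that of exponent 0, so coset
  -- representatives from K are the centres of a finite cover.
  refine ⟨Set.range fun c : P.ball 0 ⧸ (P.ball n).addSubgroupOf (P.ball 0) =>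
    P.toLocal (c.out : K), Set.finite_range _, fun x hx => ?_⟩
  obtain ⟨y, hy⟩ := P.exists_localVal_sub_le x n
  have hyb : y ∈ P.ball 0 := by
    rw [mem_ball, ← localVal_toLocal, WithZero.exp_zero,
      show P.toLocal y = x - (x - P.toLocal y) by ring]
    refine (Valuation.map_sub _ _ _).trans (max_le hx (hy.trans ?_))
    rw [← WithZero.exp_zero, WithZero.exp_le_exp]
    exact hn0
  let c : P.ball 0 ⧸ (P.ball n).addSubgroupOf (P.ball 0) := QuotientAddGroup.mk ⟨y, hyb⟩
  have hc : -(c.out : K) + y ∈ P.ball n := by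
    have : -c.out + ⟨y, hyb⟩ ∈ (P.ball n).addSubgroupOf (P.ball 0) := by
      rw [← QuotientAddGroup.eq, QuotientAddGroup.out_eq']
    exact this
  simp only [Set.mem_iUnion, Set.mem_range, exists_prop]
  refine ⟨_, ⟨c, rfl⟩, Set.mem_vadd_set_iff_neg_vadd_mem.mpr (hU' _ ?_)⟩
  rw [vadd_eq_add, show -P.toLocal (c.out : K) + x
    = (x - P.toLocal y) + P.toLocal (-(c.out : K) + y) by rw [map_add, map_neg]; ring]
  refine (Valuation.map_add _ _ _).trans (max_le hy ?_)
  rw [localVal_toLocal]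
  exact hc

instance [Finite k] [IsFunctionFieldOfConst k K] (P : Place k K) :
    CompactSpace P.localIntegers :=
  isCompact_iff_compactSpace.mp (isCompact_iff_totallyBounded_isComplete.mpr
    ⟨P.totallyBounded_localIntegers,
      (Valued.isClosed_valuationSubring P.LocalField).isComplete⟩)

end Place

instance : Fact (∀ P : Place k K, IsOpen (P.localIntegers : Set P.LocalField)) :=
  ⟨fun P => Valued.isOpen_valuationSubring P.LocalField⟩

end LocalFields

/-! ### The adele ring modulo K -/

section Adeles

variable (k K : Type*) [Field k] [Field K] [Algebra k K]

/-- The additive group of everywhere integral adeles. -/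
noncomputable def integralSubgroup : AddSubgroup (FunctionFieldAdeles k K) where
  carrier := integralAdeles k K
  zero_mem' := fun P => P.localIntegers.zero_mem
  add_mem' hx hy := fun P => P.localIntegers.add_mem _ _ (hx P) (hy P)
  neg_mem' hx := fun P => P.localIntegers.neg_mem _ (hx P)

theorem isOpen_integralAdeles : IsOpen (integralAdeles k K) :=
  RestrictedProduct.isOpen_forall_mem fun P => Valued.isOpen_valuationSubring P.LocalField

/-- Repartitions, viewed as adeles. -/
noncomputable def repartitionsToAdeles : repartitions k K →+ FunctionFieldAdeles k K where
  toFun a := ⟨fun P => P.toLocal (a.1 P), by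
    filter_upwards [a.2] with P hP
    change P.localVal (P.toLocal (a.1 P)) ≤ 1
    rwa [P.localVal_toLocal]⟩
  map_zero' := by ext P; exact map_zero P.toLocal
  map_add' a b := by ext P; exact map_add P.toLocal _ _

theorem repartitionsToAdeles_apply (a : repartitions k K) (P : Place k K) :
    repartitionsToAdeles k K a P = P.toLocal (a.1 P) := rfl

/-- Density of K in K_P approximates each coordinate up to an integral error; the approximants are
integral wherever the adele is. -/
theorem range_sup_integralSubgroup :
    (repartitionsToAdeles k K).range ⊔ integralSubgroup k K = ⊤ := by
  refine eq_top_iff.mpr fun a _ => ?_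
  choose y hy using fun P : Place k K => P.exists_localVal_sub_le (a P) 0
  have hrep : y ∈ repartitions k K := by
    change ∀ᶠ P : Place k K in Filter.cofinite, P.val (y P) ≤ 1
    filter_upwards [a.2] with P hP
    rw [← P.localVal_toLocal, show P.toLocal (y P) = a P - (a P - P.toLocal (y P)) by ring]
    exact (Valuation.map_sub _ _ _).trans (max_le hP (hy P))
  rw [show a = repartitionsToAdeles k K ⟨y, hrep⟩ + (a - repartitionsToAdeles k K ⟨y, hrep⟩) by abel]
  exact AddSubgroup.add_mem_sup ⟨_, rfl⟩ fun P => hy P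

variable [Finite k] [IsFunctionFieldOfConst k K]

theorem exists_mem_principalAdeles (x : K) :
    ∃ a ∈ principalAdeles k K, ∀ P : Place k K, a P = P.toLocal x :=
  ⟨repartitionsToAdeles k K ⟨fun _ => x, eventually_val_le_one x⟩, ⟨x, fun _ => rfl⟩, fun _ => rfl⟩

theorem isCompact_integralAdeles : IsCompact (integralAdeles k K) := by
  have h : integralAdeles k K = Set.range (RestrictedProduct.structureMap
      (fun P : Place k K => P.LocalField) (fun P => (P.localIntegers : Set P.LocalField))
      Filter.cofinite) := by
    rw [RestrictedProduct.range_structureMap]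
    rfl
  have : ∀ P : Place k K, CompactSpace (P.localIntegers : Set P.LocalField) := fun P =>
    inferInstanceAs (CompactSpace P.localIntegers)
  rw [h]
  exact isCompact_range RestrictedProduct.isEmbedding_structureMap.continuous

theorem discreteTopology_principalAdeles : DiscreteTopology (principalAdeles k K) := by
  obtain ⟨P⟩ := nonempty_place k K
  -- An integral principal adele is a constant, and a constant of positive valuation at P is 0; so U
  -- isolates 0.
  let U : Set (FunctionFieldAdeles k K) :=
    integralAdeles k K ∩ (fun a => a P) ⁻¹' {x | P.localVal x ≤ WithZero.exp (-1)}
  have hU : IsOpen U := (isOpen_integralAdeles k K).inter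
    ((P.isOpen_setOf_localVal_le (-1)).preimage (RestrictedProduct.continuous_eval P))
  refine discreteTopology_of_isOpen_singleton_zero ?_
  convert hU.preimage continuous_subtype_val
  ext ⟨a, x, hx⟩
  constructor
  · intro h
    obtain rfl : a = 0 := congrArg Subtype.val h
    exact ⟨(integralSubgroup k K).zero_mem, by
      change P.localVal 0 ≤ _
      simp⟩
  · rintro ⟨h1, h2⟩
    change P.localVal (a P) ≤ _ at h2
    have hx0 : x ∈ riemannRochSpace k K 0 := fun Q => by
      have := h1 Q
      rwa [Place.mem_localIntegers, hx Q, Q.localVal_toLocal] at this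
    obtain ⟨c, rfl⟩ := (riemannRochSpace_zero k K x).mp hx0
    rw [hx P, P.localVal_toLocal] at h2
    have hc : c = 0 := by
      by_contra hc
      rw [P.map_const c hc, ← WithZero.exp_zero, WithZero.exp_le_exp] at h2
      norm_num at h2
    refine Subtype.ext (RestrictedProduct.ext _ _ fun Q => ?_)
    change a Q = 0
    rw [hx Q, hc, map_zero, map_zero]

theorem comap_repartitionsToAdeles :
    (integralSubgroup k K ⊔ principalAdeles k K).comap (repartitionsToAdeles k K) =
      (adelicSpace 0 ⊔ (diagonalHom k K).range).addSubgroupOf (repartitions k K).toAddSubgroup := by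
  ext a
  rw [AddSubgroup.mem_comap, AddSubgroup.mem_addSubgroupOf, AddSubgroup.mem_sup, AddSubgroup.mem_sup]
  constructor
  · rintro ⟨b, hb, p, ⟨x, hx⟩, h⟩
    refine ⟨a.1 - diagonalHom k K x, mem_adelicSpace.mpr fun P => ?_, _, ⟨x, rfl⟩, sub_add_cancel _ _⟩
    have h1 : b P + p P = P.toLocal (a.1 P) := congrArg (fun y : FunctionFieldAdeles k K => y P) h
    rw [Pi.sub_apply, diagonalHom_apply, ← P.localVal_toLocal, map_sub, ← h1, hx P, add_sub_cancel_right]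
    exact hb P
  · rintro ⟨b, hb, _, ⟨x, rfl⟩, h⟩
    refine ⟨repartitionsToAdeles k K ⟨b, adelicSpace_le_repartitions 0 hb⟩, fun P => ?_,
      repartitionsToAdeles k K ⟨diagonalHom k K x, range_diagonalHom_le k K ⟨x, rfl⟩⟩,
      ⟨x, fun _ => rfl⟩, ?_⟩
    · rw [Place.mem_localIntegers, repartitionsToAdeles_apply, P.localVal_toLocal]
      exact mem_adelicSpace.mp hb P
    · rw [← map_add]
      exact congrArg _ (Subtype.ext h)

/-- Repartitions and integral adeles together span the adeles, so the index can be computed after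
pulling back to repartitions, where the subgroup becomes A(0) + K. -/
theorem index_integralSubgroup_sup :
    (integralSubgroup k K ⊔ principalAdeles k K).index
      = specialityIndex (0 : WeilDivisor k K) := by
  rw [specialityIndex, AddSubgroup.relIndex, ← comap_repartitionsToAdeles, AddSubgroup.index_comap,
    ← AddSubgroup.relIndex_sup_right, ← sup_assoc, range_sup_integralSubgroup, top_sup_eq,
    AddSubgroup.relIndex_top_right]

/-- The constants are the everywhere integral principal adeles. -/
noncomputable def riemannRochSpaceEquivIntegralPrincipal :
    riemannRochSpace k K 0 ≃ (integralSubgroup k K ⊓ principalAdeles k K :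
      AddSubgroup (FunctionFieldAdeles k K)) :=
  Equiv.ofBijective (fun x => ⟨repartitionsToAdeles k K ⟨fun _ => x.1, eventually_val_le_one x.1⟩,
    fun P => by
      rw [Place.mem_localIntegers, repartitionsToAdeles_apply, P.localVal_toLocal]
      exact x.2 P, ⟨x.1, fun _ => rfl⟩⟩) ⟨fun x y h => by
    obtain ⟨P⟩ := nonempty_place k K
    have h1 : P.toLocal x.1 = P.toLocal y.1 :=
      congrArg (fun a : FunctionFieldAdeles k K => a P) (congrArg Subtype.val h)
    exact Subtype.ext (P.toLocal.injective h1), by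
    rintro ⟨a, ha, x, hx⟩
    refine ⟨⟨x, fun P => ?_⟩, Subtype.ext (RestrictedProduct.ext _ _ fun P => (hx P).symm)⟩
    rw [← P.localVal_toLocal, ← hx P]
    exact ha P⟩

theorem card_integralSubgroup_inf :
    Nat.card (integralSubgroup k K ⊓ principalAdeles k K : AddSubgroup (FunctionFieldAdeles k K))
      = Nat.card k := by
  rw [← Nat.card_congr (riemannRochSpaceEquivIntegralPrincipal k K), card_riemannRochSpace_zero]

theorem countable_principalAdeles [Countable K] : Countable (principalAdeles k K) := by
  refine Function.Surjective.countable (f := fun x : K =>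
    (⟨_, (exists_mem_principalAdeles k K x).choose_spec.1⟩ : principalAdeles k K)) ?_
  rintro ⟨a, x, hx⟩
  exact ⟨x, Subtype.ext (RestrictedProduct.ext _ _ fun P =>
    ((exists_mem_principalAdeles k K x).choose_spec.2 P).trans (hx P).symm)⟩

theorem exists_isAddHaarMeasure : ∃ μ : Measure (FunctionFieldAdeles k K),
    μ.IsAddHaarMeasure ∧ μ (integralAdeles k K) = 1 := by
  let K₀ : TopologicalSpace.PositiveCompacts (FunctionFieldAdeles k K) :=
    { carrier := integralAdeles k K
      isCompact' := isCompact_integralAdeles k K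
      interior_nonempty' := by
        rw [(isOpen_integralAdeles k K).interior_eq]
        exact ⟨0, (integralSubgroup k K).zero_mem⟩ }
  exact ⟨Measure.addHaarMeasure K₀, inferInstance, Measure.addHaarMeasure_self⟩

end Adeles

/-! ### Finite extensions of k(t), and the volume of the quotient -/

theorem FunctionField.isFunctionFieldOfConst {k K : Type*} [Field k] [Field K] [Algebra k K]
    [Algebra (RatFunc k) K] [IsScalarTower k (RatFunc k) K] [FunctionField k K]
    (hconst : ∀ x : K, IsAlgebraic k x → x ∈ (algebraMap k K).range) :
    IsFunctionFieldOfConst k K where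
  finite_adjoin _ hz := FunctionField.finiteDimensional_of_adjoin_transcendental hz
  mem_range := hconst
  exists_transcendental := ⟨algebraMap (RatFunc k) K RatFunc.X,
    (transcendental_algebraMap_iff (algebraMap (RatFunc k) K).injective).mpr
      RatFunc.transcendental_X⟩

theorem FunctionField.countable (k K : Type*) [Field k] [Finite k] [Field K]
    [Algebra (RatFunc k) K] [FunctionField k K] : Countable K := by
  have : Countable (Polynomial k) := Cardinal.mk_le_aleph0_iff.mp
    (Polynomial.cardinalMk_le_max.trans (max_le Cardinal.mk_le_aleph0 le_rfl))
  have : Countable (RatFunc k) := by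
    refine Function.Surjective.countable (f := fun p : Polynomial k × Polynomial k =>
      algebraMap (Polynomial k) (RatFunc k) p.1 / algebraMap (Polynomial k) (RatFunc k) p.2) ?_
    intro x
    obtain ⟨a, b, -, h⟩ := IsFractionRing.div_surjective (Polynomial k) x
    exact ⟨(a, b), h⟩
  exact Function.Injective.countable (Module.finBasis (RatFunc k) K).equivFun.injective

theorem mainTheorem10 (k K : Type*) [Field k] [Finite k] [Field K] [Algebra k K]
    [Algebra (RatFunc k) K] [IsScalarTower k (RatFunc k) K] [FunctionField k K]
    (hconst : ∀ x : K, IsAlgebraic k x → x ∈ (algebraMap k K).range) :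
    -- the field embeds diagonally in the adele ring, as a discrete subgroup
    (∀ x : K, ∃ a ∈ principalAdeles k K, ∀ P : Place k K, a P = P.toLocal x) ∧
    DiscreteTopology (principalAdeles k K) ∧
    -- the genus is well defined, and the normalised Haar measure exists
    ∃ g : ℕ, IsGenus k K g ∧
      (∃ μ : Measure (FunctionFieldAdeles k K),
        μ.IsAddHaarMeasure ∧ μ (integralAdeles k K) = 1) ∧
      ∀ μ : Measure (FunctionFieldAdeles k K),
        μ.IsAddHaarMeasure → μ (integralAdeles k K) = 1 →
        -- the induced measure on the quotient exists and has total mass `q ^ (g - 1)`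
        (∃ ν : Measure (FunctionFieldAdeles k K ⧸ principalAdeles k K),
          IsQuotientMeasure (principalAdeles k K) μ ν) ∧
        ∀ ν : Measure (FunctionFieldAdeles k K ⧸ principalAdeles k K),
          IsQuotientMeasure (principalAdeles k K) μ ν →
          ν Set.univ = (Nat.card k : ℝ≥0∞) ^ ((g : ℤ) - 1) := by
  have := FunctionField.isFunctionFieldOfConst hconst
  have := FunctionField.countable k K
  have := countable_principalAdeles k K
  obtain ⟨g, hg, hcard⟩ := exists_isGenus k K
  refine ⟨exists_mem_principalAdeles k K, discreteTopology_principalAdeles k K, g, hg,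
    exists_isAddHaarMeasure k K, fun μ hμ hμ1 => ?_⟩
  have hmeas : MeasurableSet (integralSubgroup k K : Set (FunctionFieldAdeles k K)) :=
    (isOpen_integralAdeles k K).measurableSet
  have : Finite (integralSubgroup k K ⊓ principalAdeles k K :
      AddSubgroup (FunctionFieldAdeles k K)) :=
    Finite.of_equiv _ (riemannRochSpaceEquivIntegralPrincipal k K)
  have hindex : Nat.card (FunctionFieldAdeles k K ⧸ (integralSubgroup k K ⊔ principalAdeles k K))
      = Nat.card k ^ g := (index_integralSubgroup_sup k K).trans hcard
  have : Finite (FunctionFieldAdeles k K ⧸ (integralSubgroup k K ⊔ principalAdeles k K)) :=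
    Nat.finite_of_card_ne_zero (hindex ▸ pow_ne_zero _ Nat.card_pos.ne')
  refine ⟨exists_isQuotientMeasure _ (integralSubgroup k K) hmeas μ, fun ν hν => ?_⟩
  -- This becomes q ν(Â/K) = q^g; dividing by q in `ℝ≥0∞` is legitimate as q is neither 0 nor ∞.
  have h := hν.measure_univ _ (integralSubgroup k K) hmeas
  have h1 : μ (integralSubgroup k K : Set (FunctionFieldAdeles k K)) = 1 := hμ1
  have hq0 : (Nat.card k : ℝ≥0∞) ≠ 0 := Nat.cast_ne_zero.mpr Nat.card_pos.ne'
  have hqt : (Nat.card k : ℝ≥0∞) ≠ ∞ := ENNReal.natCast_ne_top _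
  rw [h1, mul_one, card_integralSubgroup_inf, hindex, Nat.cast_pow] at h
  rw [sub_eq_add_neg, ENNReal.zpow_add hq0 hqt, zpow_natCast, zpow_neg_one, ← h, mul_comm,
    ← mul_assoc, ENNReal.inv_mul_cancel hq0 hqt, one_mul]
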